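/- For $z\in\mathbb{R}$ let $\mathrm{int}(z)$ denote its integer part. Let $$R=\{y\in\mathbb{R}^2 : y_2\ge 1,\ |y_1|\le 3^{1-\mathrm{int}(y_2)}\}$$ and let $\pi$ be the probability distribution on $\mathbb{R}^2$ whose Lebesgue density (the "rectangle" density) satisfies $\pi(x)\propto 3^{-\mathrm{int}(x_2)}\mathbf{1}_R(x)$. For $x\in\mathbb{R}^2$ let $$E_x=\{y\in\mathbb{R}^2 : 3^{2(\mathrm{int}(x_2)-1)}(y_1-x_1)^2+(y_2-x_2)^2\le 1\}$$ be the ellipse centred at $x$ with horizontal semi-axis $3^{1-\mathrm{int}(x_2)}$ and vertical semi-axis $1$, and let $Q(x,\cdot)$ be the uniform distribution on $E_x$, with density $q(y|x)=\mathbf{1}_{E_x}(y)/|E_x|$. Let $$P(x,dy)=\alpha(x,y)\,Q(x,dy)+r(x)\,\delta_x(dy),\qquad \alpha(x,y)=1\wedge\frac{\pi(y)q(x|y)}{\pi(x)q(y|x)},\qquad r(x)=1-\int\alpha(x,y)\,Q(x,dy)$$ (with $\alpha(x,y)=1$ where the denominator vanishes) be the corresponding Metropolis--Hastings kernel. Then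 $P$ is geometrically ergodic from $\pi$-almost every starting point: there are a function $M:\mathbb{R}^2\to(0,\infty)$ and a constant $\rho\in(0,1)$ such that for $\pi$-almost every $x$ and every $n\ge 0$, $$\|P^n(x,\cdot)-\pi\|_{TV}=\sup_{A}|P^n(x,A)-\pi(A)|\le M(x)\,\rho^n ,$$ the supremum being over Borel sets $A\subseteq\mathbb{R}^2$. -/

import Mathlib

open MeasureTheory ProbabilityTheory

noncomputable section

/-- Total variation distance `sup_A |μ(A) - ν(A)|`, over measurable sets `A`. -/
def tvDist {X : Type*} [MeasurableSpace X] (μ ν : Measure X) : ℝ :=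
  ⨆ A : {A : Set X // MeasurableSet A}, |μ.real A - ν.real A|

/-- `P` is geometrically ergodic with limiting distribution `π`, from `π`-almost any starting
point: `‖Pⁿ(x, ·) - π‖_TV ≤ M(x) ρⁿ` for all `n`, with `M(x) > 0` finite and `ρ < 1`.
Here `P ^ n` is the `n`-step transition kernel. -/
def GeometricallyErgodic {X : Type*} [MeasurableSpace X]
    (P : Kernel X X) [IsMarkovKernel P] (π : Measure X) [IsProbabilityMeasure π] : Prop :=
  ∃ (M : X → ℝ) (ρ : ℝ), (∀ x, 0 < M x) ∧ 0 < ρ ∧ ρ < 1 ∧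
    ∀ᵐ x ∂π, ∀ n : ℕ, tvDist ((P ^ n) x) π ≤ M x * ρ ^ n

section MetropolisHastings

variable {X : Type*} [MeasureSpace X]

/-- Metropolis--Hastings acceptance rate `1 ∧ p(y) q(x|y) / (p(x) q(y|x))`, where `q x y` stands
for `q(y|x)`; it is `1` by the usual convention where the denominator vanishes. -/
def mhAccept (p : X → ENNReal) (q : X → X → ENNReal) (x y : X) : ENNReal :=
  open Classical in if p x * q x y = 0 then 1 else min 1 (p y * q y x / (p x * q x y))

/-- Rejection probability `r(x) = 1 - ∫ α(x,y) q(y|x) dy`. -/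
def mhReject (p : X → ENNReal) (q : X → X → ENNReal) (x : X) : ENNReal :=
  1 - ∫⁻ y, mhAccept p q x y * q x y

theorem measurable_mhAccept {p : X → ENNReal} {q : X → X → ENNReal} (hp : Measurable p)
    (hq : Measurable (Function.uncurry q)) : Measurable (Function.uncurry (mhAccept p q)) := by
  have h1 : Measurable fun z : X × X => p z.1 * q z.1 z.2 :=
    (hp.comp measurable_fst).mul hq
  have h2 : Measurable fun z : X × X => p z.2 * q z.2 z.1 :=
    (hp.comp measurable_snd).mul (hq.comp measurable_swap)
  exact Measurable.ite (h1 (measurableSet_singleton 0)) measurable_const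
    (measurable_const.min (h2.div h1))

theorem measurable_mhAccept_mul {p : X → ENNReal} {q : X → X → ENNReal} (hp : Measurable p)
    (hq : Measurable (Function.uncurry q)) :
    Measurable (Function.uncurry fun x y => mhAccept p q x y * q x y) :=
  (measurable_mhAccept hp hq).mul hq

/-- Metropolis--Hastings kernel `P(x, dy) = α(x,y) q(y|x) dy + r(x) δ_x(dy)` with target density
`p` and proposal density `q`. -/
def mhKernel [SFinite (volume : Measure X)] (p : X → ENNReal) (q : X → X → ENNReal)
    (hp : Measurable p) (hq : Measurable (Function.uncurry q)) : Kernel X X where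
  toFun x := (volume.withDensity fun y => mhAccept p q x y * q x y) +
    mhReject p q x • Measure.dirac x
  measurable' := by
    have hm := measurable_mhAccept_mul hp hq
    refine Measure.measurable_of_measurable_coe _ fun s hs => ?_
    simp only [Measure.coe_add, Pi.add_apply, Measure.smul_apply, smul_eq_mul,
      withDensity_apply _ hs, Measure.dirac_apply' _ hs]
    refine Measurable.add ?_ (Measurable.mul ?_ (measurable_one.indicator hs))
    · exact hm.lintegral_prod_right'
    · exact measurable_const.sub hm.lintegral_prod_right'

theorem isMarkovKernel_mhKernel [SFinite (volume : Measure X)] {p : X → ENNReal}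
    {q : X → X → ENNReal} (hp : Measurable p) (hq : Measurable (Function.uncurry q))
    (hq1 : ∀ x, ∫⁻ y, q x y = 1) : IsMarkovKernel (mhKernel p q hp hq) := by
  refine ⟨fun x => ⟨?_⟩⟩
  have hle : ∫⁻ y, mhAccept p q x y * q x y ≤ 1 := by
    rw [← hq1 x]
    refine lintegral_mono fun y => mul_le_of_le_one_left' ?_
    unfold mhAccept
    split_ifs
    · exact le_rfl
    · exact min_le_left _ _
  change ((volume.withDensity fun y => mhAccept p q x y * q x y) +
    mhReject p q x • Measure.dirac x) Set.univ = 1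
  simp only [Measure.coe_add, Pi.add_apply, Measure.smul_apply, smul_eq_mul,
    withDensity_apply _ MeasurableSet.univ, Measure.restrict_univ, measure_univ, mul_one]
  exact add_tsub_cancel_of_le hle

end MetropolisHastings

/-- The region `R = {y : y₂ ≥ 1, |y₁| ≤ 3^(1 - int(y₂))}`. -/
def rectRegion : Set (ℝ × ℝ) :=
  {y | 1 ≤ y.2 ∧ |y.1| ≤ (3 : ℝ) ^ (1 - ⌊y.2⌋)}

/-- Unnormalised rectangle density `3^(-int(x₂)) 1_R(x)`. -/
def rectWeight : ℝ × ℝ → ENNReal :=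
  rectRegion.indicator fun x => ENNReal.ofReal ((3 : ℝ) ^ (-⌊x.2⌋))

/-- The rectangle density, normalised with respect to Lebesgue measure on the plane. -/
def rectDensity (x : ℝ × ℝ) : ENNReal :=
  (∫⁻ y, rectWeight y)⁻¹ * rectWeight x

/-- The probability distribution with the rectangle density. -/
def rectMeasure : Measure (ℝ × ℝ) := volume.withDensity rectDensity

/-- The full ellipse centred at `x` with horizontal semi-axis `3^(1 - int(x₂))` and vertical
semi-axis `1`. -/
def ellipse (x : ℝ × ℝ) : Set (ℝ × ℝ) :=
  {y | (3 : ℝ) ^ (2 * (⌊x.2⌋ - 1)) * (y.1 - x.1) ^ 2 + (y.2 - x.2) ^ 2 ≤ 1}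

/-- Density `q(y|x) = 1_{E_x}(y) / |E_x|` of the uniform proposal on the ellipse at `x`. -/
def ellipseProposal (x y : ℝ × ℝ) : ENNReal :=
  (ellipse x).indicator (fun _ => (volume (ellipse x))⁻¹) y

theorem measurable_zpow_floor {X : Type*} [MeasurableSpace X] (g : ℤ → ℤ) {f : X → ℝ}
    (hf : Measurable f) : Measurable fun x => (3 : ℝ) ^ g ⌊f x⌋ :=
  (measurable_from_top (f := fun k : ℤ => (3 : ℝ) ^ g k)).comp hf.floor

theorem measurableSet_rectRegion : MeasurableSet rectRegion :=
  (measurableSet_le measurable_const measurable_snd).inter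
    (measurableSet_le measurable_fst.abs (measurable_zpow_floor (fun k => 1 - k) measurable_snd))

theorem measurable_rectWeight : Measurable rectWeight :=
  (measurable_zpow_floor (fun k => -k) measurable_snd).ennreal_ofReal.indicator
    measurableSet_rectRegion

theorem measurable_rectDensity : Measurable rectDensity :=
  measurable_const.mul measurable_rectWeight

theorem measurableSet_ellipse_graph :
    MeasurableSet {z : (ℝ × ℝ) × (ℝ × ℝ) | z.2 ∈ ellipse z.1} := by
  have h := measurable_zpow_floor (X := (ℝ × ℝ) × (ℝ × ℝ)) (fun k => 2 * (k - 1))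
    (f := fun z => z.1.2) (by fun_prop)
  refine measurableSet_le ((h.mul ?_).add ?_) measurable_const <;> fun_prop

theorem measurableSet_ellipse (x : ℝ × ℝ) : MeasurableSet (ellipse x) :=
  measurable_prodMk_left measurableSet_ellipse_graph

theorem measurable_ellipseProposal : Measurable (Function.uncurry ellipseProposal) :=
  ((measurable_measure_prodMk_left (ν := (volume : Measure (ℝ × ℝ)))
    measurableSet_ellipse_graph).inv.comp measurable_fst).indicator measurableSet_ellipse_graph

theorem volume_ellipse_ne_zero (x : ℝ × ℝ) : volume (ellipse x) ≠ 0 := by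
  have ho : IsOpen {y : ℝ × ℝ |
      (3 : ℝ) ^ (2 * (⌊x.2⌋ - 1)) * (y.1 - x.1) ^ 2 + (y.2 - x.2) ^ 2 < 1} :=
    isOpen_lt (by fun_prop) continuous_const
  have hpos := ho.measure_pos volume ⟨x, by simp⟩
  refine (hpos.trans_le (measure_mono ?_)).ne'
  exact Set.ofPred_subset_ofPred.2 fun y hy => le_of_lt hy

theorem volume_ellipse_ne_top (x : ℝ × ℝ) : volume (ellipse x) ≠ ⊤ := by
  set a : ℝ := (3 : ℝ) ^ (1 - ⌊x.2⌋) with ha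
  have ha0 : 0 < a := by positivity
  have hsub : ellipse x ⊆ Set.Icc (x.1 - a) (x.1 + a) ×ˢ Set.Icc (x.2 - 1) (x.2 + 1) := by
    intro y hy
    have hy' : (3 : ℝ) ^ (2 * (⌊x.2⌋ - 1)) * (y.1 - x.1) ^ 2 + (y.2 - x.2) ^ 2 ≤ 1 := hy
    have hb : (3 : ℝ) ^ (2 * (⌊x.2⌋ - 1)) = (a⁻¹) ^ 2 := by
      rw [ha, ← zpow_neg, ← zpow_natCast, ← zpow_mul]
      congr 1
      push_cast
      ring
    rw [hb, ← mul_pow] at hy'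
    have h1 : |a⁻¹ * (y.1 - x.1)| ≤ 1 :=
      (sq_le_one_iff_abs_le_one _).1 (by nlinarith [sq_nonneg (y.2 - x.2)])
    have h2 : |y.2 - x.2| ≤ 1 :=
      (sq_le_one_iff_abs_le_one _).1 (by nlinarith [sq_nonneg (a⁻¹ * (y.1 - x.1))])
    rw [abs_mul, abs_of_pos (inv_pos.2 ha0), inv_mul_le_iff₀ ha0, mul_one, abs_le] at h1
    rw [abs_le] at h2
    exact ⟨⟨by linarith, by linarith⟩, ⟨by linarith, by linarith⟩⟩
  exact ((measure_mono hsub).trans_lt (isCompact_Icc.prod isCompact_Icc).measure_lt_top).ne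

theorem lintegral_ellipseProposal (x : ℝ × ℝ) : ∫⁻ y, ellipseProposal x y = 1 := by
  unfold ellipseProposal
  rw [lintegral_indicator_const (measurableSet_ellipse x)]
  exact ENNReal.inv_mul_cancel (volume_ellipse_ne_zero x) (volume_ellipse_ne_top x)

theorem lintegral_rectWeight_ne_zero : ∫⁻ y, rectWeight y ≠ 0 := by
  have hsub : Set.Ioo (-1 : ℝ) 1 ×ˢ Set.Ioo (1 : ℝ) 2 ⊆ Function.support rectWeight := by
    rintro ⟨a, b⟩ ⟨h1, h2⟩
    have hf : ⌊b⌋ = 1 := Int.floor_eq_iff.2 ⟨by simpa using h2.1.le, by push_cast; linarith [h2.2]⟩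
    have hm : (a, b) ∈ rectRegion :=
      ⟨h2.1.le, by simpa [hf] using abs_le.2 ⟨h1.1.le, h1.2.le⟩⟩
    rw [Function.mem_support, rectWeight, Set.indicator_of_mem hm]
    exact (ENNReal.ofReal_pos.2 (by positivity)).ne'
  refine ((lintegral_pos_iff_support measurable_rectWeight).2
    (lt_of_lt_of_le ?_ (measure_mono hsub))).ne'
  exact (isOpen_Ioo.prod isOpen_Ioo).measure_pos volume ⟨(0, 3 / 2), by constructor <;> norm_num⟩

theorem lintegral_rectWeight_ne_top : ∫⁻ y, rectWeight y ≠ ⊤ := by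
  have hle : ∀ y : ℝ × ℝ, rectWeight y ≤ (Set.Icc (-1 : ℝ) 1).indicator 1 y.1 *
      (Set.Ioi (0 : ℝ)).indicator (fun t => ENNReal.ofReal (3 * Real.exp (-t))) y.2 := by
    rintro ⟨a, b⟩
    by_cases hm : (a, b) ∈ rectRegion
    · have hm' : 1 ≤ b ∧ |a| ≤ (3 : ℝ) ^ (1 - ⌊b⌋) := hm
      obtain ⟨h1, h2⟩ := hm'
      have hfl : 1 ≤ ⌊b⌋ := Int.le_floor.2 (by simpa using h1)
      have ha : a ∈ Set.Icc (-1 : ℝ) 1 :=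
        abs_le.1 (h2.trans (zpow_le_one_of_nonpos₀ (by norm_num) (by omega)))
      have hb : b ∈ Set.Ioi (0 : ℝ) := lt_of_lt_of_le one_pos h1
      rw [rectWeight, Set.indicator_of_mem hm, Set.indicator_of_mem ha, Set.indicator_of_mem hb,
        Pi.one_apply, one_mul]
      refine ENNReal.ofReal_le_ofReal ?_
      obtain ⟨n, hn⟩ := Int.eq_ofNat_of_zero_le (zero_le_one.trans hfl)
      have hbn : b < n + 1 := by
        have := Int.lt_floor_add_one b
        rw [hn] at this
        exact_mod_cast this
      change (3 : ℝ) ^ (-⌊b⌋) ≤ 3 * Real.exp (-b)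
      have he : Real.exp 1 ≤ 3 := by linarith [Real.exp_one_lt_d9]
      rw [hn, zpow_neg, Real.exp_neg, ← div_eq_mul_inv, inv_eq_one_div,
        div_le_div_iff₀ (by positivity) (Real.exp_pos b), one_mul]
      calc Real.exp b ≤ Real.exp ((n + 1 : ℕ) * 1) := Real.exp_le_exp.2 (by push_cast; linarith)
        _ = Real.exp 1 ^ (n + 1) := Real.exp_nat_mul 1 (n + 1)
        _ ≤ 3 ^ (n + 1) := pow_le_pow_left₀ (Real.exp_pos 1).le he _
        _ = 3 * (3 : ℝ) ^ (n : ℤ) := by rw [zpow_natCast, pow_succ, mul_comm]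
    · rw [rectWeight, Set.indicator_of_notMem hm]
      exact zero_le
  have hint : IntegrableOn (fun t : ℝ => 3 * Real.exp (-t)) (Set.Ioi 0) :=
    (integrableOn_exp_neg_Ioi 0).const_mul 3
  refine ((lintegral_mono hle).trans_lt ?_).ne
  rw [Measure.volume_eq_prod, lintegral_prod_mul
    (measurable_one.indicator measurableSet_Icc).aemeasurable
    (Measurable.indicator (by fun_prop) measurableSet_Ioi).aemeasurable,
    lintegral_indicator_one measurableSet_Icc, lintegral_indicator measurableSet_Ioi]
  exact ENNReal.mul_lt_top isCompact_Icc.measure_lt_top hint.lintegral_lt_top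

instance isProbabilityMeasure_rectMeasure : IsProbabilityMeasure rectMeasure := by
  refine ⟨?_⟩
  rw [rectMeasure, withDensity_apply _ MeasurableSet.univ, Measure.restrict_univ]
  unfold rectDensity
  rw [lintegral_const_mul _ measurable_rectWeight]
  exact ENNReal.inv_mul_cancel lintegral_rectWeight_ne_zero lintegral_rectWeight_ne_top

/-- The Metropolis--Hastings chain for the rectangle density with the uniform ellipse proposal. -/
def rectChain : Kernel (ℝ × ℝ) (ℝ × ℝ) :=
  mhKernel rectDensity ellipseProposal measurable_rectDensity measurable_ellipseProposal

instance isMarkovKernel_rectChain : IsMarkovKernel rectChain :=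
  isMarkovKernel_mhKernel _ _ lintegral_ellipseProposal

end

/-! The weight 3^(-k) of level k and the area of its ellipses, proportional to 3^(1-k), scale alike,
so π(x) q(y|x) has one and the same value for all x in the region and y in E_x. Hence the acceptance
probability is 0 or 1: a proposal y is accepted exactly when y lies in the region and x ∈ E_y
(`rectDensity_mul_ellipseProposal`, `rectChain_apply`). The chain is reversible
(`rectChain_isReversible`), and it remains to verify the hypotheses of Harris' theorem
(`geometricallyErgodic_of_drift_of_minorization`).

Drift: pair the accepted moves up by t and down by t. Within one level they balance. A move that
crosses down is not obstructed, because the strip below is three times as wide, whereas a move that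
crosses up must respect the narrower ellipse there. The mean height change can still vanish, as at
the bottom centre of a level, so the potential also counts levels, with weight 1/100. Its mean
increment is then at most a negative constant at heights at least 2
(`integral_heightPotential_sub_rectChain_le`). As the increments are bounded, the exponential of a
small multiple of the potential satisfies a geometric drift condition
(`lintegral_driftFunction_le`).

Minorization: from any point the chain can enter the core of its level, and from the core the level
below, each with probability at least 1/100. Below a given height it thus reaches the core of level
1 in a common number of steps, and from there it spreads over a fixed rectangle
(`exists_minorization`). -/

/-! ### Harris' theorem through contraction of weighted oscillations -/

theorem exists_center_of_pairwise {X : Type*} {R : Set X} {f g : X → ℝ}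
    (h : ∀ x ∈ R, ∀ y ∈ R, f x - f y ≤ g x + g y) : ∃ c, ∀ x ∈ R, |f x - c| ≤ g x := by
  rcases R.eq_empty_or_nonempty with rfl | ⟨x₀, hx₀⟩
  · exact ⟨0, by simp⟩
  have hne : ((fun x => f x - g x) '' R).Nonempty := ⟨_, x₀, hx₀, rfl⟩
  have hbd : BddAbove ((fun x => f x - g x) '' R) := by
    refine ⟨f x₀ + g x₀, ?_⟩
    rintro _ ⟨x, hx, rfl⟩
    have := h x hx x₀ hx₀
    simp only
    linarith
  -- The hypothesis says that every value of f - g is at most every value of f + g; any number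
  -- separating the two sets is a centre.
  refine ⟨sSup ((fun x => f x - g x) '' R), fun x hx => abs_le.2 ⟨?_, ?_⟩⟩
  · have : sSup ((fun x => f x - g x) '' R) ≤ f x + g x := by
      refine csSup_le hne ?_
      rintro _ ⟨y, hy, rfl⟩
      have := h y hy x hx
      simp only
      linarith
    linarith
  · have := le_csSup hbd ⟨x, hx, rfl⟩
    simp only at this
    linarith

section Measures

variable {X : Type*} [MeasurableSpace X]

theorem integrable_of_lintegral_ofReal_le {μ : Measure X} {V : X → ℝ} (hVm : Measurable V)
    (hV0 : ∀ x, 0 ≤ V x) {b : ℝ} (h : ∫⁻ x, ENNReal.ofReal (V x) ∂μ ≤ ENNReal.ofReal b) :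
    Integrable V μ :=
  ⟨hVm.aestronglyMeasurable, (hasFiniteIntegral_iff_ofReal (Filter.Eventually.of_forall hV0)).2
    (h.trans_lt ENNReal.ofReal_lt_top)⟩

theorem integral_le_of_lintegral_ofReal_le {μ : Measure X} {V : X → ℝ} (hVm : Measurable V)
    (hV0 : ∀ x, 0 ≤ V x) {b : ℝ} (hb : 0 ≤ b)
    (h : ∫⁻ x, ENNReal.ofReal (V x) ∂μ ≤ ENNReal.ofReal b) : ∫ x, V x ∂μ ≤ b := by
  rw [integral_eq_lintegral_of_nonneg_ae (Filter.Eventually.of_forall hV0)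
    hVm.aestronglyMeasurable]
  exact ENNReal.toReal_le_of_le_ofReal hb h

theorem abs_integral_sub_const_le {μ : Measure X} [IsFiniteMeasure μ] {R : Set X}
    (hR : ∀ᵐ x ∂μ, x ∈ R) {φ V : X → ℝ} (hV : Integrable V μ)
    {c κ β : ℝ} (h : ∀ x ∈ R, |φ x - c| ≤ κ * (1 + β * V x)) :
    |∫ x, (φ x - c) ∂μ| ≤ κ * (μ.real Set.univ + β * ∫ x, V x ∂μ) := by
  have hi : Integrable (fun x => κ * (1 + β * V x)) μ :=
    ((integrable_const 1).add (hV.const_mul β)).const_mul κ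
  have hle := norm_integral_le_of_norm_le hi (f := fun x => φ x - c) (by
    filter_upwards [hR] with x hx using h x hx)
  rw [integral_const_mul, integral_add (integrable_const 1) (hV.const_mul β), integral_const,
    integral_const_mul, smul_eq_mul, mul_one] at hle
  exact hle

/-- The common part `ν` cancels in the difference. Only the two remainders, each of mass 1 - ν(X),
see the oscillation of `φ` about `c`. The case `ν = 0` is also useful. -/
theorem abs_integral_sub_integral_le {μ₁ μ₂ : Measure X} [IsProbabilityMeasure μ₁]
    [IsProbabilityMeasure μ₂] {R : Set X} (hR₁ : ∀ᵐ x ∂μ₁, x ∈ R) (hR₂ : ∀ᵐ x ∂μ₂, x ∈ R)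
    {φ V : X → ℝ} (hφ₁ : Integrable φ μ₁) (hφ₂ : Integrable φ μ₂) (hV₁ : Integrable V μ₁)
    (hV₂ : Integrable V μ₂) (hV0 : ∀ x, 0 ≤ V x) {c κ β : ℝ} (hκ : 0 ≤ κ) (hβ : 0 ≤ β)
    (h : ∀ x ∈ R, |φ x - c| ≤ κ * (1 + β * V x)) {ν : Measure X} (hν₁ : ν ≤ μ₁) (hν₂ : ν ≤ μ₂) :
    |∫ x, φ x ∂μ₁ - ∫ x, φ x ∂μ₂| ≤
      κ * (2 - 2 * ν.real Set.univ + β * (∫ x, V x ∂μ₁ + ∫ x, V x ∂μ₂)) := by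
  have hνf : IsFiniteMeasure ν := isFiniteMeasure_of_le μ₁ hν₁
  have key : ∀ μ : Measure X, IsProbabilityMeasure μ → (∀ᵐ x ∂μ, x ∈ R) → Integrable φ μ →
      Integrable V μ → ν ≤ μ → |∫ x, φ x ∂μ - c - ∫ x, (φ x - c) ∂ν| ≤
        κ * (1 - ν.real Set.univ + β * ∫ x, V x ∂μ) := by
    intro μ hμ hR hφ hV hν
    have hs : μ - ν + ν = μ := Measure.sub_add_cancel_of_le hν
    have hle : μ - ν ≤ μ := Measure.sub_le
    have hfin : IsFiniteMeasure (μ - ν) := isFiniteMeasure_of_le μ hle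
    have hc : Integrable (fun x => φ x - c) μ := hφ.sub (integrable_const c)
    have e1 : ∫ x, φ x ∂μ - c = ∫ x, (φ x - c) ∂(μ - ν) + ∫ x, (φ x - c) ∂ν := by
      rw [← integral_add_measure (hc.mono_measure hle) (hc.mono_measure hν), hs,
        integral_sub hφ (integrable_const c)]
      simp
    have e2 : (μ - ν).real Set.univ = 1 - ν.real Set.univ := by
      have : (μ - ν + ν).real Set.univ = 1 := by rw [hs]; simp
      rw [measureReal_add_apply] at this
      linarith
    have e3 := abs_integral_sub_const_le ((Measure.absolutelyContinuous_of_le hle) hR)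
      (hV.mono_measure hle) h
    rw [e2] at e3
    have e4 : ∫ x, V x ∂(μ - ν) ≤ ∫ x, V x ∂μ :=
      integral_mono_measure hle (Filter.Eventually.of_forall hV0) hV
    rw [e1, add_sub_cancel_right]
    refine e3.trans (mul_le_mul_of_nonneg_left ?_ hκ)
    gcongr
  have h1 := abs_le.1 (key μ₁ inferInstance hR₁ hφ₁ hV₁ hν₁)
  have h2 := abs_le.1 (key μ₂ inferInstance hR₂ hφ₂ hV₂ hν₂)
  refine abs_le.2 ⟨?_, ?_⟩ <;> nlinarith [h1.1, h1.2, h2.1, h2.2]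

end Measures

section Harris

variable {X : Type*} [MeasurableSpace X]

theorem integrable_of_abs_le_one {μ : Measure X} [IsFiniteMeasure μ] {φ : X → ℝ}
    (hφ : Measurable φ) (h1 : ∀ x, |φ x| ≤ 1) : Integrable φ μ :=
  Integrable.of_bound hφ.aestronglyMeasurable 1 (Filter.Eventually.of_forall h1)

/-- One step of a kernel satisfying a drift condition and a minorization condition on a sublevel
set of the drift function contracts the weighted oscillation of bounded functions. -/
theorem weighted_oscillation_contraction (Q : Kernel X X) [IsMarkovKernel Q] {R : Set X}
    (habs : ∀ x ∈ R, ∀ᵐ y ∂(Q x), y ∈ R) {V : X → ℝ} (hVm : Measurable V) (hV0 : ∀ x, 0 ≤ V x)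
    {γ K : ℝ} (hγ0 : 0 < γ) (hγ1 : γ < 1) (hK : 0 < K)
    (hdrift : ∀ x ∈ R, ∫⁻ y, ENNReal.ofReal (V y) ∂(Q x) ≤ ENNReal.ofReal (γ * V x + K))
    {ν : Measure X} (hν0 : 0 < ν.real Set.univ)
    (hν : ∀ x ∈ R, V x ≤ 4 * K / (1 - γ) → ν ≤ Q x) :
    ∃ β δ : ℝ, 0 < β ∧ 0 < δ ∧ δ < 1 ∧ ∀ φ : X → ℝ, Measurable φ → (∀ x, |φ x| ≤ 1) →
      ∀ κ : ℝ, 0 ≤ κ → (∃ c, ∀ x ∈ R, |φ x - c| ≤ κ * (1 + β * V x)) →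
        ∃ c, ∀ x ∈ R, |∫ y, φ y ∂(Q x) - c| ≤ (1 - δ) * κ * (1 + β * V x) := by
  set η := ν.real Set.univ with hη
  obtain ⟨β, hβ⟩ : ∃ β, β = η / (2 * K) := ⟨_, rfl⟩
  obtain ⟨δ, hδ⟩ : ∃ δ, δ = min (η / 4) ((1 - γ) / 4) := ⟨_, rfl⟩
  have hβ0 : 0 < β := by rw [hβ]; positivity
  have hβK : 2 * (β * K) = η := by rw [hβ]; field_simp
  have hδ1 : δ ≤ η / 4 := hδ ▸ min_le_left _ _
  have hδ2 : δ ≤ (1 - γ) / 4 := hδ ▸ min_le_right _ _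
  have hδ0 : 0 < δ := by rw [hδ]; exact lt_min (by linarith) (by linarith)
  refine ⟨β, δ, hβ0, hδ0, by linarith, fun φ hφm hφ1 κ hκ ⟨c, hc⟩ => ?_⟩
  refine exists_center_of_pairwise fun x hx y hy => ?_
  have hb : ∀ z, 0 ≤ γ * V z + K := fun z => by have := hV0 z; positivity
  have hVx := integrable_of_lintegral_ofReal_le hVm hV0 (hdrift x hx)
  have hVy := integrable_of_lintegral_ofReal_le hVm hV0 (hdrift y hy)
  have hIx := integral_le_of_lintegral_ofReal_le hVm hV0 (hb x) (hdrift x hx)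
  have hIy := integral_le_of_lintegral_ofReal_le hVm hV0 (hb y) (hdrift y hy)
  have hs0 : 0 ≤ β * (V x + V y) := mul_nonneg hβ0.le (add_nonneg (hV0 x) (hV0 y))
  have hI : β * (∫ z, V z ∂(Q x) + ∫ z, V z ∂(Q y)) ≤ γ * (β * (V x + V y)) + η := by
    have := mul_le_mul_of_nonneg_left (add_le_add hIx hIy) hβ0.le
    linarith
  have main : ∀ t, |∫ z, φ z ∂(Q x) - ∫ z, φ z ∂(Q y)| ≤
      κ * (2 - 2 * t + β * (∫ z, V z ∂(Q x) + ∫ z, V z ∂(Q y))) →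
      2 - 2 * t + (γ * (β * (V x + V y)) + η) ≤ (1 - δ) * (2 + β * (V x + V y)) →
      ∫ z, φ z ∂(Q x) - ∫ z, φ z ∂(Q y) ≤
        (1 - δ) * κ * (1 + β * V x) + (1 - δ) * κ * (1 + β * V y) := by
    intro t h1 h2
    have h3 := (le_abs_self _).trans h1
    have h4 := mul_le_mul_of_nonneg_left (h2.trans' (by linarith : 2 - 2 * t +
      β * (∫ z, V z ∂(Q x) + ∫ z, V z ∂(Q y)) ≤ _)) hκ
    linarith
  rcases le_total (V x + V y) (4 * K / (1 - γ)) with hle | hle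
  -- Both points lie in the small set: the overlap gains 2η, the drift constant costs η, and 2δ ≤
  -- η/2.
  · refine main η (abs_integral_sub_integral_le (habs x hx) (habs y hy)
      (integrable_of_abs_le_one hφm hφ1) (integrable_of_abs_le_one hφm hφ1) hVx hVy hV0 hκ hβ0.le
      hc (hν x hx (by linarith [hV0 y])) (hν y hy (by linarith [hV0 x]))) ?_
    nlinarith [mul_le_mul_of_nonneg_right hδ2 hs0, mul_nonneg (by linarith : 0 ≤ 1 - γ) hs0]
  -- No overlap is needed far out. The drift gains (1 - γ)β(V x + V y) ≥ 2η; half of it pays for η,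
  -- a quarter for 2δ and a quarter for δβ(V x + V y).
  · refine main 0 ?_ ?_
    · simpa using abs_integral_sub_integral_le (habs x hx) (habs y hy)
        (integrable_of_abs_le_one hφm hφ1) (integrable_of_abs_le_one hφm hφ1) hVx hVy hV0 hκ
        hβ0.le hc (ν := 0) (Measure.zero_le _) (Measure.zero_le _)
    · have h1 : 4 * K ≤ (1 - γ) * (V x + V y) := by
        rw [div_le_iff₀ (by linarith)] at hle
        linarith
      have h2 : 2 * η ≤ (1 - γ) * (β * (V x + V y)) := by
        nlinarith [mul_le_mul_of_nonneg_left h1 hβ0.le]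
      nlinarith [mul_le_mul_of_nonneg_right hδ2 hs0, mul_nonneg (by linarith : 0 ≤ 1 - γ) hs0]

theorem isMarkovKernel_pow (P : Kernel X X) [IsMarkovKernel P] (n : ℕ) :
    IsMarkovKernel (P ^ n) := by
  induction n with
  | zero => rw [pow_zero]; exact inferInstanceAs (IsMarkovKernel (Kernel.id : Kernel X X))
  | succ n ih => rw [pow_succ]; exact inferInstanceAs (IsMarkovKernel ((P ^ n) ∘ₖ P))

theorem invariant_pow {P : Kernel X X} {π : Measure X} (h : P.Invariant π) (n : ℕ) :
    (P ^ n).Invariant π := by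
  induction n with
  | zero => rw [pow_zero]; exact Measure.bind_dirac
  | succ n ih => rw [pow_succ]; exact ih.comp h

theorem ae_mem_pow {P : Kernel X X} {R : Set X} (hR : MeasurableSet R)
    (habs : ∀ x ∈ R, ∀ᵐ y ∂(P x), y ∈ R) (n : ℕ) : ∀ x ∈ R, ∀ᵐ y ∂((P ^ n) x), y ∈ R := by
  induction n with
  | zero =>
    intro x hx
    rw [pow_zero]
    change ∀ᵐ y ∂(Kernel.id x), y ∈ R
    rw [Kernel.id_apply]
    exact (ae_dirac_iff (p := fun y => y ∈ R) hR).2 hx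
  | succ n ih =>
    intro x hx
    rw [pow_succ]
    refine Kernel.ae_comp_of_ae_ae hR ?_
    filter_upwards [habs x hx] with y hy using ih y hy

/-- The constant K/(1 - γ) is the fixed point of k ↦ γk + K, so one pair of constants serves all
positive powers. -/
theorem lintegral_pow_drift {P : Kernel X X} [IsMarkovKernel P] {R : Set X}
    (hR : MeasurableSet R)
    (habs : ∀ x ∈ R, ∀ᵐ y ∂(P x), y ∈ R) {V : X → ℝ} (hVm : Measurable V) (hV0 : ∀ x, 0 ≤ V x)
    {γ K : ℝ} (hγ0 : 0 < γ) (hγ1 : γ < 1) (hK : 0 < K)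
    (hdrift : ∀ x ∈ R, ∫⁻ y, ENNReal.ofReal (V y) ∂(P x) ≤ ENNReal.ofReal (γ * V x + K)) (n : ℕ) :
    ∀ x ∈ R, ∫⁻ y, ENNReal.ofReal (V y) ∂((P ^ (n + 1)) x) ≤
      ENNReal.ofReal (γ * V x + K / (1 - γ)) := by
  have h1 : 0 < 1 - γ := by linarith
  have hK' : γ * (K / (1 - γ)) + K = K / (1 - γ) := by field_simp; ring
  induction n with
  | zero =>
    intro x hx
    rw [zero_add, pow_one]
    refine (hdrift x hx).trans (ENNReal.ofReal_le_ofReal ?_)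
    have : 0 < γ * (K / (1 - γ)) := by positivity
    linarith
  | succ n ih =>
    intro x hx
    rw [pow_succ']
    change ∫⁻ y, _ ∂((P ∘ₖ (P ^ (n + 1))) x) ≤ _
    have hM := isMarkovKernel_pow P (n + 1)
    rw [Kernel.lintegral_comp _ _ _ hVm.ennreal_ofReal]
    have hVx := hV0 x
    calc ∫⁻ y, ∫⁻ z, ENNReal.ofReal (V z) ∂(P y) ∂((P ^ (n + 1)) x)
        ≤ ∫⁻ y, (ENNReal.ofReal γ * ENNReal.ofReal (V y) + ENNReal.ofReal K)
            ∂((P ^ (n + 1)) x) := by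
          refine lintegral_mono_ae ?_
          filter_upwards [ae_mem_pow hR habs (n + 1) x hx] with y hy
          refine (hdrift y hy).trans_eq ?_
          rw [ENNReal.ofReal_add (by have := hV0 y; positivity) (by positivity),
            ENNReal.ofReal_mul hγ0.le]
      _ = ENNReal.ofReal γ * ∫⁻ y, ENNReal.ofReal (V y) ∂((P ^ (n + 1)) x) +
            ENNReal.ofReal K := by
          rw [lintegral_add_right _ measurable_const, lintegral_const_mul _ hVm.ennreal_ofReal]
          simp
      _ ≤ ENNReal.ofReal γ * ENNReal.ofReal (γ * V x + K / (1 - γ)) + ENNReal.ofReal K := by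
          gcongr
          exact ih x hx
      _ = ENNReal.ofReal (γ * (γ * V x + K / (1 - γ)) + K) := by
          rw [← ENNReal.ofReal_mul hγ0.le, ← ENNReal.ofReal_add (by positivity) (by positivity)]
      _ ≤ ENNReal.ofReal (γ * V x + K / (1 - γ)) := by
          refine ENNReal.ofReal_le_ofReal ?_
          nlinarith [mul_nonneg hγ0.le hVx]

theorem integral_measureReal_kernel {μ : Measure X} [IsFiniteMeasure μ] (P : Kernel X X)
    [IsMarkovKernel P] {A : Set X} (hA : MeasurableSet A) :
    ∫ y, (P y).real A ∂μ = (μ.bind P).real A := by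
  rw [measureReal_def, Measure.bind_apply hA P.aemeasurable]
  exact integral_toReal (P.measurable_coe hA).aemeasurable
    (Filter.Eventually.of_forall fun y => measure_lt_top _ _)

/-- Harris' theorem: a Markov kernel with an invariant distribution, a geometric drift condition
and minorized sublevel sets of the drift function is geometrically ergodic. -/
theorem geometricallyErgodic_of_drift_of_minorization (P : Kernel X X) [IsMarkovKernel P]
    (π : Measure X) [IsProbabilityMeasure π] (hinv : P.Invariant π) {R : Set X}
    (hR : MeasurableSet R) (hπR : ∀ᵐ x ∂π, x ∈ R) (habs : ∀ x ∈ R, ∀ᵐ y ∂(P x), y ∈ R)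
    {V : X → ℝ} (hVm : Measurable V) (hV0 : ∀ x, 0 ≤ V x) (hVπ : Integrable V π)
    {γ K : ℝ} (hγ0 : 0 < γ) (hγ1 : γ < 1) (hK : 0 < K)
    (hdrift : ∀ x ∈ R, ∫⁻ y, ENNReal.ofReal (V y) ∂(P x) ≤ ENNReal.ofReal (γ * V x + K))
    (hsmall : ∀ C : ℝ, ∃ (m : ℕ) (ν : Measure X), IsFiniteMeasure ν ∧ ν Set.univ ≠ 0 ∧
      ∀ x ∈ R, V x ≤ C → ν ≤ (P ^ (m + 1)) x) :
    GeometricallyErgodic P π := by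
  have hK' : 0 < K / (1 - γ) := div_pos hK (by linarith)
  -- The drift constants of `P ^ (m + 1)` do not depend on `m`, so the sublevel can be fixed before
  -- `m` is known.
  obtain ⟨m, ν, hνf, hν0, hν⟩ := hsmall (4 * (K / (1 - γ)) / (1 - γ))
  have hM := isMarkovKernel_pow P
  obtain ⟨β, δ, hβ0, hδ0, hδ1, hcon⟩ := weighted_oscillation_contraction (P ^ (m + 1))
    (ae_mem_pow hR habs (m + 1)) hVm hV0 hγ0 hγ1 hK'
    (lintegral_pow_drift hR habs hVm hV0 hγ0 hγ1 hK hdrift m)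
    (ENNReal.toReal_pos hν0 (measure_ne_top _ _)) hν
  have hθ0 : 0 < 1 - δ := by linarith
  have hθ1 : 1 - δ < 1 := by linarith
  have habs1 : ∀ (n : ℕ) (A : Set X) (x : X), |((P ^ n) x).real A| ≤ 1 := fun n A x => by
    rw [abs_of_nonneg measureReal_nonneg]
    exact measureReal_le_one
  have hmeas : ∀ (n : ℕ) {A : Set X}, MeasurableSet A → Measurable fun x => ((P ^ n) x).real A :=
    fun n A hA => ((P ^ n).measurable_coe hA).ennreal_toReal
  -- The contraction acts on the functions x ↦ Pⁿ(x, A), which start with weighted oscillation at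
  -- most 1 about 0.
  have hosc : ∀ (j r : ℕ) (A : Set X), MeasurableSet A → ∃ c, ∀ x ∈ R,
      |((P ^ (r + (m + 1) * j)) x).real A - c| ≤ (1 - δ) ^ j * (1 + β * V x) := by
    intro j r A hA
    induction j with
    | zero =>
      refine ⟨0, fun x _ => ?_⟩
      rw [sub_zero, pow_zero, one_mul]
      exact (habs1 _ _ _).trans (by linarith [mul_nonneg hβ0.le (hV0 x)])
    | succ j ih =>
      obtain ⟨c, hc⟩ := hcon _ (hmeas (r + (m + 1) * j) hA) (habs1 _ A) _ (pow_nonneg hθ0.le j) ih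
      refine ⟨c, fun x hx => ?_⟩
      have := hc x hx
      rw [integral_measureReal_kernel _ hA] at this
      rw [pow_succ', show r + (m + 1) * (j + 1) = r + (m + 1) * j + (m + 1) by ring,
        Kernel.pow_add]
      exact this
  have hI0 : 0 ≤ ∫ x, V x ∂π := integral_nonneg hV0
  have hbound : ∀ (j r : ℕ) (A : Set X), MeasurableSet A → ∀ x ∈ R,
      |((P ^ (r + (m + 1) * j)) x).real A - π.real A| ≤
        (1 - δ) ^ j * (2 + β * V x + β * ∫ x, V x ∂π) := by
    intro j r A hA x hx
    obtain ⟨c, hc⟩ := hosc j r A hA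
    -- By invariance the π-average of Pⁿ(·, A) is π(A), so π(A) is close to the unknown centre `c`.
    have h1 := abs_integral_sub_const_le hπR hVπ hc
    rw [integral_sub (integrable_of_abs_le_one (hmeas _ hA) (habs1 _ A)) (integrable_const c),
      integral_measureReal_kernel _ hA, (invariant_pow hinv _).def] at h1
    simp only [integral_const, probReal_univ, smul_eq_mul, one_mul] at h1
    have h2 := abs_le.1 (hc x hx)
    have h3 := abs_le.1 h1
    exact abs_le.2 ⟨by linarith [h2.1, h3.2], by linarith [h2.2, h3.1]⟩
  -- The rate per step is the (m+1)-st root of the rate per block; dividing by 1 - δ in the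
  -- prefactor makes up for the last, incomplete block.
  obtain ⟨ρ, hρ⟩ : ∃ ρ : ℝ, ρ = (1 - δ) ^ ((m + 1 : ℕ) : ℝ)⁻¹ := ⟨_, rfl⟩
  have hρ0 : 0 < ρ := hρ ▸ Real.rpow_pos_of_pos hθ0 _
  have hρ1 : ρ < 1 := hρ ▸ Real.rpow_lt_one hθ0.le hθ1 (by positivity)
  have hρm : ρ ^ (m + 1) = 1 - δ := by
    rw [hρ]
    exact Real.rpow_inv_natCast_pow hθ0.le (Nat.succ_ne_zero m)
  refine ⟨fun x => (2 + β * V x + β * ∫ x, V x ∂π) / (1 - δ), ρ, fun x => ?_, hρ0, hρ1, ?_⟩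
  · have := hV0 x
    positivity
  filter_upwards [hπR] with x hx n
  have hVx := hV0 x
  refine ciSup_le fun A => ?_
  have h := hbound (n / (m + 1)) (n % (m + 1)) A.1 A.2 x hx
  rw [Nat.mod_add_div] at h
  refine h.trans ?_
  have hpow : (1 - δ) ^ (n / (m + 1)) * (1 - δ) ≤ ρ ^ n := by
    rw [← pow_succ, ← hρm, ← pow_mul]
    exact pow_le_pow_of_le_one hρ0.le hρ1.le (Nat.lt_mul_div_succ n (Nat.succ_pos m)).le
  rw [div_mul_eq_mul_div, le_div_iff₀ hθ0]
  nlinarith [mul_le_mul_of_nonneg_left hpow (by positivity : 0 ≤ 2 + β * V x + β * ∫ x, V x ∂π)]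

end Harris

/-! ### Acceptance is 0 or 1: the explicit form of the chain -/

/-- The half-width `3^(1 - int(t))` at height `t` of the region and of the ellipses centred there. -/
noncomputable def halfWidth (t : ℝ) : ℝ := (3 : ℝ) ^ (1 - ⌊t⌋)

theorem halfWidth_pos (t : ℝ) : 0 < halfWidth t := by unfold halfWidth; positivity

theorem mem_rectRegion {y : ℝ × ℝ} : y ∈ rectRegion ↔ 1 ≤ y.2 ∧ |y.1| ≤ halfWidth y.2 := Iff.rfl

theorem mem_ellipse {x y : ℝ × ℝ} :
    y ∈ ellipse x ↔ ((halfWidth x.2)⁻¹ * (y.1 - x.1)) ^ 2 + (y.2 - x.2) ^ 2 ≤ 1 := by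
  have h : (3 : ℝ) ^ (2 * (⌊x.2⌋ - 1)) = ((halfWidth x.2)⁻¹) ^ 2 := by
    rw [halfWidth, ← zpow_neg, ← zpow_natCast, ← zpow_mul]
    congr 1
    push_cast
    ring
  rw [mul_pow, ← h]
  rfl

/-- Only proportionality to the half-width matters. The area of the disc is a common factor, of
which it suffices to know that it is positive and at most 4. -/
theorem volume_ellipse (x : ℝ × ℝ) :
    volume (ellipse x) = ENNReal.ofReal (halfWidth x.2) *
      volume {y : ℝ × ℝ | y.1 ^ 2 + y.2 ^ 2 ≤ 1} := by
  have hd : MeasurableSet {y : ℝ × ℝ | y.1 ^ 2 + y.2 ^ 2 ≤ 1} :=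
    measurableSet_le (by fun_prop) measurable_const
  have ha := halfWidth_pos x.2
  have hsec : ∀ s : ℝ, volume ((fun r => (r, s)) ⁻¹' ellipse x) =
      ENNReal.ofReal (halfWidth x.2) * volume {r : ℝ | r ^ 2 + (s - x.2) ^ 2 ≤ 1} := by
    intro s
    have : (fun r => (r, s)) ⁻¹' ellipse x =
        (fun r => r + -x.1) ⁻¹' ((fun r => (halfWidth x.2)⁻¹ * r) ⁻¹'
          {r : ℝ | r ^ 2 + (s - x.2) ^ 2 ≤ 1}) := by
      ext r
      simp only [Set.mem_preimage, mem_ellipse]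
      rfl
    rw [this, measure_preimage_add_right, Real.volume_preimage_mul_left (inv_ne_zero ha.ne'),
      inv_inv, abs_of_pos ha]
  rw [Measure.volume_eq_prod, Measure.prod_apply_symm (measurableSet_ellipse x),
    Measure.prod_apply_symm hd]
  simp_rw [hsec]
  have hm : Measurable fun s : ℝ => volume {r : ℝ | r ^ 2 + s ^ 2 ≤ 1} :=
    measurable_measure_prodMk_right hd
  have hm' : Measurable fun s : ℝ => volume {r : ℝ | r ^ 2 + (s - x.2) ^ 2 ≤ 1} :=
    hm.comp (measurable_id.sub_const x.2)
  rw [lintegral_const_mul _ hm']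
  congr 1
  exact lintegral_sub_right_eq_self (fun s : ℝ => volume {r : ℝ | r ^ 2 + s ^ 2 ≤ 1}) x.2

theorem volume_disc_ne_zero : volume {y : ℝ × ℝ | y.1 ^ 2 + y.2 ^ 2 ≤ 1} ≠ 0 := fun h =>
  volume_ellipse_ne_zero 0 (by rw [volume_ellipse, h, mul_zero])

theorem volume_disc_ne_top : volume {y : ℝ × ℝ | y.1 ^ 2 + y.2 ^ 2 ≤ 1} ≠ ⊤ := fun h =>
  volume_ellipse_ne_top 0 (by
    rw [volume_ellipse, h, ENNReal.mul_top (ENNReal.ofReal_pos.2 (halfWidth_pos _)).ne'])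

theorem volume_ellipse_le (x : ℝ × ℝ) : volume (ellipse x) ≤ ENNReal.ofReal (4 * halfWidth x.2) := by
  have hsub : {y : ℝ × ℝ | y.1 ^ 2 + y.2 ^ 2 ≤ 1} ⊆ Set.Icc (-1) 1 ×ˢ Set.Icc (-1) 1 := by
    intro y hy
    have hy' : y.1 ^ 2 + y.2 ^ 2 ≤ 1 := hy
    exact ⟨abs_le.1 ((sq_le_one_iff_abs_le_one _).1 (by nlinarith [sq_nonneg y.2])),
      abs_le.1 ((sq_le_one_iff_abs_le_one _).1 (by nlinarith [sq_nonneg y.1]))⟩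
  have h4 : volume {y : ℝ × ℝ | y.1 ^ 2 + y.2 ^ 2 ≤ 1} ≤ ENNReal.ofReal 4 := by
    refine (measure_mono hsub).trans_eq ?_
    rw [Measure.volume_eq_prod, Measure.prod_prod, Real.volume_Icc,
      ← ENNReal.ofReal_mul (by norm_num)]
    norm_num
  rw [volume_ellipse, mul_comm, ENNReal.ofReal_mul (by norm_num)]
  gcongr

/-- The points to which the chain at `x` moves when they are proposed. -/
def moveSet (x : ℝ × ℝ) : Set (ℝ × ℝ) := {y | y ∈ rectRegion ∧ y ∈ ellipse x ∧ x ∈ ellipse y}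

theorem measurableSet_moveSet_graph :
    MeasurableSet {z : (ℝ × ℝ) × (ℝ × ℝ) | z.2 ∈ moveSet z.1} :=
  (measurable_snd measurableSet_rectRegion).inter
    (measurableSet_ellipse_graph.inter (measurable_swap measurableSet_ellipse_graph))

theorem measurableSet_moveSet (x : ℝ × ℝ) : MeasurableSet (moveSet x) :=
  measurable_prodMk_left measurableSet_moveSet_graph

/-- The weight 3^(-k) divided by the half-width 3^(1-k) is 1/3 at every level k; no dependence on
`x` or `y` remains. -/
theorem rectDensity_mul_ellipseProposal {x y : ℝ × ℝ} (hx : x ∈ rectRegion) (hy : y ∈ ellipse x) :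
    rectDensity x * ellipseProposal x y = (∫⁻ z, rectWeight z)⁻¹ *
      (ENNReal.ofReal 3⁻¹ * (volume {y : ℝ × ℝ | y.1 ^ 2 + y.2 ^ 2 ≤ 1})⁻¹) := by
  have ha := halfWidth_pos x.2
  rw [rectDensity, rectWeight, Set.indicator_of_mem hx, ellipseProposal, Set.indicator_of_mem hy,
    volume_ellipse, mul_assoc, ENNReal.mul_inv (Or.inl (ENNReal.ofReal_pos.2 ha).ne')
      (Or.inl ENNReal.ofReal_ne_top), ← mul_assoc (ENNReal.ofReal _),
    ← ENNReal.ofReal_inv_of_pos ha, ← ENNReal.ofReal_mul (by positivity)]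
  have h3 : (3 : ℝ) ^ (-⌊x.2⌋) * (halfWidth x.2)⁻¹ = 3⁻¹ := by
    rw [halfWidth, ← zpow_neg, ← zpow_add₀ (by norm_num)]
    have : -⌊x.2⌋ + -(1 - ⌊x.2⌋) = -1 := by ring
    rw [this, zpow_neg_one]
  rw [h3]

theorem flux_const_ne_zero : (∫⁻ z, rectWeight z)⁻¹ *
    (ENNReal.ofReal 3⁻¹ * (volume {y : ℝ × ℝ | y.1 ^ 2 + y.2 ^ 2 ≤ 1})⁻¹) ≠ 0 :=
  mul_ne_zero (ENNReal.inv_ne_zero.2 lintegral_rectWeight_ne_top)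
    (mul_ne_zero (ENNReal.ofReal_pos.2 (by norm_num)).ne'
      (ENNReal.inv_ne_zero.2 volume_disc_ne_top))

theorem flux_const_ne_top : (∫⁻ z, rectWeight z)⁻¹ *
    (ENNReal.ofReal 3⁻¹ * (volume {y : ℝ × ℝ | y.1 ^ 2 + y.2 ^ 2 ≤ 1})⁻¹) ≠ ⊤ :=
  ENNReal.mul_ne_top (ENNReal.inv_ne_top.2 lintegral_rectWeight_ne_zero)
    (ENNReal.mul_ne_top ENNReal.ofReal_ne_top (ENNReal.inv_ne_top.2 volume_disc_ne_zero))

theorem rectDensity_of_notMem {x : ℝ × ℝ} (hx : x ∉ rectRegion) : rectDensity x = 0 := by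
  rw [rectDensity, rectWeight, Set.indicator_of_notMem hx, mul_zero]

/-- For y ∈ E_x the Metropolis–Hastings ratio has a constant denominator, and its numerator is
either the same constant or 0. -/
theorem mhAccept_mul_ellipseProposal {x : ℝ × ℝ} (hx : x ∈ rectRegion) (y : ℝ × ℝ) :
    mhAccept rectDensity ellipseProposal x y * ellipseProposal x y =
      (moveSet x).indicator (fun _ => (volume (ellipse x))⁻¹) y := by
  by_cases hy : y ∈ ellipse x
  · have hpq := rectDensity_mul_ellipseProposal hx hy
    rw [mhAccept, hpq, if_neg flux_const_ne_zero]
    by_cases hm : y ∈ moveSet x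
    · rw [rectDensity_mul_ellipseProposal hm.1 hm.2.2,
        ENNReal.div_self flux_const_ne_zero flux_const_ne_top, min_self, one_mul,
        Set.indicator_of_mem hm, ellipseProposal, Set.indicator_of_mem hy]
    · have h0 : rectDensity y * ellipseProposal y x = 0 := by
        by_cases hyR : y ∈ rectRegion
        · have : x ∉ ellipse y := fun h => hm ⟨hyR, hy, h⟩
          rw [ellipseProposal, Set.indicator_of_notMem this, mul_zero]
        · rw [rectDensity_of_notMem hyR, zero_mul]
      rw [h0, ENNReal.zero_div, min_eq_right zero_le, zero_mul, Set.indicator_of_notMem hm]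
  · have hm : y ∉ moveSet x := fun h => hy h.2.1
    rw [Set.indicator_of_notMem hm, ellipseProposal, Set.indicator_of_notMem hy, mul_zero]

theorem rectChain_apply {x : ℝ × ℝ} (hx : x ∈ rectRegion) :
    rectChain x = (volume (ellipse x))⁻¹ • volume.restrict (moveSet x) +
      mhReject rectDensity ellipseProposal x • Measure.dirac x := by
  change (volume.withDensity fun y => mhAccept rectDensity ellipseProposal x y *
    ellipseProposal x y) + _ = _
  simp_rw [mhAccept_mul_ellipseProposal hx]
  rw [withDensity_indicator (measurableSet_moveSet x), withDensity_const]

theorem ae_mem_rectRegion_rectChain {x : ℝ × ℝ} (hx : x ∈ rectRegion) :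
    ∀ᵐ y ∂(rectChain x), y ∈ rectRegion := by
  rw [rectChain_apply hx, ae_add_measure_iff]
  refine ⟨Measure.ae_smul_measure ?_ _, Measure.ae_smul_measure ?_ _⟩
  · filter_upwards [ae_restrict_mem (measurableSet_moveSet x)] with y hy using hy.1
  · exact (ae_dirac_iff (p := fun y => y ∈ rectRegion) measurableSet_rectRegion).2 hx

theorem ae_mem_rectRegion_rectMeasure : ∀ᵐ x ∂rectMeasure, x ∈ rectRegion := by
  rw [rectMeasure, ae_withDensity_iff measurable_rectDensity]
  exact Filter.Eventually.of_forall fun x hx => by_contra fun h => hx (rectDensity_of_notMem h)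

/-! ### Detailed balance -/

theorem flux_symm (x y : ℝ × ℝ) :
    rectDensity x * (mhAccept rectDensity ellipseProposal x y * ellipseProposal x y) =
      rectDensity y * (mhAccept rectDensity ellipseProposal y x * ellipseProposal y x) := by
  by_cases hx : x ∈ rectRegion
  · by_cases hy : y ∈ rectRegion
    · rw [mhAccept_mul_ellipseProposal hx, mhAccept_mul_ellipseProposal hy]
      by_cases hm : y ∈ moveSet x
      · have hm' : x ∈ moveSet y := ⟨hx, hm.2.2, hm.2.1⟩
        have h1 := rectDensity_mul_ellipseProposal hx hm.2.1
        have h2 := rectDensity_mul_ellipseProposal hy hm.2.2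
        rw [ellipseProposal, Set.indicator_of_mem hm.2.1] at h1
        rw [ellipseProposal, Set.indicator_of_mem hm.2.2] at h2
        rw [Set.indicator_of_mem hm, Set.indicator_of_mem hm', h1, h2]
      · have hm' : x ∉ moveSet y := fun h => hm ⟨hy, h.2.2, h.2.1⟩
        rw [Set.indicator_of_notMem hm, Set.indicator_of_notMem hm', mul_zero, mul_zero]
    · have hm : y ∉ moveSet x := fun h => hy h.1
      rw [mhAccept_mul_ellipseProposal hx, Set.indicator_of_notMem hm, rectDensity_of_notMem hy,
        mul_zero, zero_mul]
  · rw [rectDensity_of_notMem hx, zero_mul]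
    by_cases hy : y ∈ rectRegion
    · have hm : x ∉ moveSet y := fun h => hx h.1
      rw [mhAccept_mul_ellipseProposal hy, Set.indicator_of_notMem hm, mul_zero]
    · rw [rectDensity_of_notMem hy, zero_mul]

theorem rectChain_isReversible : rectChain.IsReversible rectMeasure := by
  intro A B hA hB
  have hm := measurable_mhAccept_mul measurable_rectDensity measurable_ellipseProposal
  have hrej : Measurable (mhReject rectDensity ellipseProposal) :=
    measurable_const.sub hm.lintegral_prod_right'
  have key : ∀ S T : Set (ℝ × ℝ), MeasurableSet S → MeasurableSet T →
      -- The flow splits into a part with symmetric density and a rejection part on the diagonal,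
      -- which sees only T ∩ S; both are symmetric in S and T.
      ∫⁻ x in S, rectChain x T ∂rectMeasure =
        (∫⁻ x in S, ∫⁻ y in T, rectDensity x *
          (mhAccept rectDensity ellipseProposal x y * ellipseProposal x y)) +
        ∫⁻ x in T ∩ S, rectDensity x * mhReject rectDensity ellipseProposal x := by
    intro S T hS hT
    rw [rectMeasure, restrict_withDensity hS,
      lintegral_withDensity_eq_lintegral_mul _ measurable_rectDensity (rectChain.measurable_coe hT)]
    have hpt : ∀ x, (rectDensity * fun x => rectChain x T) x =
        (∫⁻ y in T, rectDensity x *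
          (mhAccept rectDensity ellipseProposal x y * ellipseProposal x y)) +
        T.indicator (fun x => rectDensity x * mhReject rectDensity ellipseProposal x) x := by
      intro x
      have : rectChain x T = (∫⁻ y in T,
          mhAccept rectDensity ellipseProposal x y * ellipseProposal x y) +
          mhReject rectDensity ellipseProposal x * T.indicator 1 x := by
        change ((volume.withDensity fun y => mhAccept rectDensity ellipseProposal x y *
          ellipseProposal x y) + mhReject rectDensity ellipseProposal x • Measure.dirac x) T = _
        rw [Measure.add_apply, Measure.smul_apply, withDensity_apply _ hT,
          Measure.dirac_apply' _ hT, smul_eq_mul]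
      have hmx : Measurable fun y =>
          mhAccept rectDensity ellipseProposal x y * ellipseProposal x y :=
        hm.comp measurable_prodMk_left
      rw [Pi.mul_apply, this, mul_add, lintegral_const_mul _ hmx]
      congr 1
      by_cases hxT : x ∈ T <;> simp [hxT]
    have hmr : Measurable (T.indicator fun x =>
        rectDensity x * mhReject rectDensity ellipseProposal x) :=
      (measurable_rectDensity.mul hrej).indicator hT
    rw [lintegral_congr hpt, lintegral_add_right _ hmr, lintegral_indicator hT,
      Measure.restrict_restrict hT]
  rw [key A B hA hB, key B A hB hA, Set.inter_comm]
  congr 1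
  rw [lintegral_lintegral_swap
    ((measurable_rectDensity.comp measurable_fst).mul hm).aemeasurable]
  simp_rw [flux_symm]

/-! ### Horizontal sections of the set of accepted moves -/

theorem mem_ellipse_iff_abs_le {a t z : ℝ} (ha : 0 < a) (ht : |t| ≤ 1) :
    (a⁻¹ * z) ^ 2 + t ^ 2 ≤ 1 ↔ |z| ≤ a * √(1 - t ^ 2) := by
  have h : 0 ≤ 1 - t ^ 2 := by linarith [(sq_le_one_iff_abs_le_one t).2 ht]
  rw [← inv_mul_le_iff₀ ha, ← le_sub_iff_add_le, ← Real.sqrt_le_sqrt_iff h, Real.sqrt_sq_eq_abs,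
    abs_mul, abs_of_pos (inv_pos.2 ha)]

theorem abs_sub_le_one_of_mem_moveSet {x y : ℝ × ℝ} (h : y ∈ moveSet x) : |y.2 - x.2| ≤ 1 := by
  have := mem_ellipse.1 h.2.1
  exact (sq_le_one_iff_abs_le_one _).1
    (by linarith [sq_nonneg ((halfWidth x.2)⁻¹ * (y.1 - x.1))])

theorem mem_moveSet_iff {x : ℝ × ℝ} {r s : ℝ} (hs : |s - x.2| ≤ 1) :
    (r, s) ∈ moveSet x ↔ (1 ≤ s ∧ |r| ≤ halfWidth s) ∧
      |r - x.1| ≤ halfWidth x.2 * √(1 - (s - x.2) ^ 2) ∧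
      |r - x.1| ≤ halfWidth s * √(1 - (s - x.2) ^ 2) := by
  have hs' : |x.2 - s| ≤ 1 := by rwa [abs_sub_comm]
  change _ ∧ _ ∧ _ ↔ _
  rw [mem_rectRegion, mem_ellipse, mem_ellipse,
    mem_ellipse_iff_abs_le (halfWidth_pos _) hs, mem_ellipse_iff_abs_le (halfWidth_pos _) hs',
    abs_sub_comm x.1, ← neg_sub s x.2, neg_sq]

/-- Length of the horizontal section at height `s` of the set of accepted moves from `x`. -/
noncomputable def sectionLength (x : ℝ × ℝ) (s : ℝ) : ℝ :=
  volume.real ((fun r => (r, s)) ⁻¹' moveSet x)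

theorem sectionLength_eq_zero {x : ℝ × ℝ} {s : ℝ} (hs : 1 < |s - x.2|) :
    sectionLength x s = 0 := by
  have : (fun r => (r, s)) ⁻¹' moveSet x = ∅ :=
    Set.eq_empty_of_forall_notMem fun r hr =>
      absurd (abs_sub_le_one_of_mem_moveSet hr) (not_le.2 hs)
  rw [sectionLength, this, measureReal_empty]

theorem sectionLength_le_of_subset {x : ℝ × ℝ} {s b : ℝ} (hb : 0 ≤ b)
    (h : ∀ r, (r, s) ∈ moveSet x → |r - x.1| ≤ b) : sectionLength x s ≤ 2 * b := by
  have hsub : (fun r => (r, s)) ⁻¹' moveSet x ⊆ Set.Icc (x.1 - b) (x.1 + b) := fun r hr => by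
    have := abs_le.1 (h r hr)
    exact ⟨by linarith, by linarith⟩
  refine (measureReal_mono hsub (by simp)).trans_eq ?_
  rw [Real.volume_real_Icc_of_le (by linarith)]
  ring

theorem le_sectionLength_of_superset {x : ℝ × ℝ} {s l u : ℝ} (hlu : l ≤ u)
    (h : ∀ r ∈ Set.Icc l u, (r, s) ∈ moveSet x) (hs : |s - x.2| ≤ 1) :
    u - l ≤ sectionLength x s := by
  rw [← Real.volume_real_Icc_of_le hlu]
  refine measureReal_mono h ?_
  have hsub : (fun r => (r, s)) ⁻¹' moveSet x ⊆ Set.Icc (-halfWidth s) (halfWidth s) :=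
    fun r hr => abs_le.1 ((mem_moveSet_iff hs).1 hr).1.2
  exact ((measure_mono hsub).trans_lt (by simp)).ne

theorem halfWidth_congr {s t : ℝ} (h : ⌊s⌋ = ⌊t⌋) : halfWidth s = halfWidth t := by
  rw [halfWidth, halfWidth, h]

theorem halfWidth_of_floor_eq_add_one {s t : ℝ} (h : ⌊s⌋ = ⌊t⌋ + 1) :
    halfWidth s = halfWidth t / 3 := by
  rw [halfWidth, halfWidth, h, show 1 - (⌊t⌋ + 1) = (1 - ⌊t⌋) - 1 by ring,
    zpow_sub_one₀ (by norm_num), div_eq_mul_inv]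

theorem sectionLength_le {x : ℝ × ℝ} {s : ℝ} (hs : |s - x.2| ≤ 1) :
    sectionLength x s ≤ 2 * (halfWidth x.2 * √(1 - (s - x.2) ^ 2)) :=
  sectionLength_le_of_subset (mul_nonneg (halfWidth_pos _).le (Real.sqrt_nonneg _))
    fun _ hr => ((mem_moveSet_iff hs).1 hr).2.1

/-- The reverse condition x ∈ E_y is the binding one: ellipses one level up are a third as wide. -/
theorem sectionLength_le_of_above {x : ℝ × ℝ} {s : ℝ} (hs : |s - x.2| ≤ 1)
    (hf : ⌊s⌋ = ⌊x.2⌋ + 1) :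
    sectionLength x s ≤ 2 / 3 * (halfWidth x.2 * √(1 - (s - x.2) ^ 2)) := by
  refine (sectionLength_le_of_subset (mul_nonneg (halfWidth_pos s).le (Real.sqrt_nonneg _))
    fun _ hr => ((mem_moveSet_iff hs).1 hr).2.2).trans_eq ?_
  rw [halfWidth_of_floor_eq_add_one hf]
  ring

/-- Nothing is cut off the section of E_x: it stays within twice the half-width at `x` from the
axis, the strip below has three times that half-width, and the ellipses there are wider. -/
theorem le_sectionLength_of_below {x : ℝ × ℝ} (hx : x ∈ rectRegion) {s : ℝ} (hs1 : 1 ≤ s)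
    (hs : |s - x.2| ≤ 1) (hf : ⌊x.2⌋ = ⌊s⌋ + 1) :
    2 * (halfWidth x.2 * √(1 - (s - x.2) ^ 2)) ≤ sectionLength x s := by
  have ha := halfWidth_pos x.2
  have hw0 := Real.sqrt_nonneg (1 - (s - x.2) ^ 2)
  have hw1 : √(1 - (s - x.2) ^ 2) ≤ 1 :=
    Real.sqrt_le_one.2 (by linarith [sq_nonneg (s - x.2)])
  have hA := mul_le_of_le_one_right ha.le hw1
  have hA0 := mul_nonneg ha.le hw0
  have h3 := halfWidth_of_floor_eq_add_one hf
  have hx1 := abs_le.1 (mem_rectRegion.1 hx).2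
  refine le_trans (le_of_eq (by ring)) (le_sectionLength_of_superset
    (l := x.1 - halfWidth x.2 * √(1 - (s - x.2) ^ 2))
    (u := x.1 + halfWidth x.2 * √(1 - (s - x.2) ^ 2)) (by linarith) (fun r hr => ?_) hs)
  have hr' : |r - x.1| ≤ halfWidth x.2 * √(1 - (s - x.2) ^ 2) :=
    abs_le.2 ⟨by linarith [hr.1], by linarith [hr.2]⟩
  refine (mem_moveSet_iff hs).2 ⟨⟨hs1, abs_le.2 ⟨?_, ?_⟩⟩, hr', hr'.trans ?_⟩
  · linarith [hr.1]
  · linarith [hr.2]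
  · gcongr
    linarith

/-- The half of the section of E_x that points from `x` towards the axis stays inside the strip. -/
theorem le_sectionLength_of_floor_eq {x : ℝ × ℝ} (hx : x ∈ rectRegion) {s : ℝ} (hs1 : 1 ≤ s)
    (hs : |s - x.2| ≤ 1) (hf : ⌊s⌋ = ⌊x.2⌋) :
    halfWidth x.2 * √(1 - (s - x.2) ^ 2) ≤ sectionLength x s := by
  have ha := halfWidth_pos x.2
  have hw0 := Real.sqrt_nonneg (1 - (s - x.2) ^ 2)
  have hw1 : √(1 - (s - x.2) ^ 2) ≤ 1 :=
    Real.sqrt_le_one.2 (by linarith [sq_nonneg (s - x.2)])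
  have hA := mul_le_of_le_one_right ha.le hw1
  have hA0 := mul_nonneg ha.le hw0
  have h3 := halfWidth_congr hf
  have hx1 := abs_le.1 (mem_rectRegion.1 hx).2
  have key : ∀ l u, u - l = halfWidth x.2 * √(1 - (s - x.2) ^ 2) → l ≤ x.1 → x.1 ≤ u →
      -halfWidth x.2 ≤ l → u ≤ halfWidth x.2 →
      halfWidth x.2 * √(1 - (s - x.2) ^ 2) ≤ sectionLength x s := by
    intro l u h1 h2 h3' h4 h5
    rw [← h1]
    refine le_sectionLength_of_superset (by linarith) (fun r hr => ?_) hs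
    have hr' : |r - x.1| ≤ halfWidth x.2 * √(1 - (s - x.2) ^ 2) :=
      abs_le.2 ⟨by linarith [hr.1], by linarith [hr.2]⟩
    exact (mem_moveSet_iff hs).2 ⟨⟨hs1, h3 ▸ abs_le.2 ⟨by linarith [hr.1], by linarith [hr.2]⟩⟩,
      hr', h3 ▸ hr'⟩
  rcases le_total 0 x.1 with h0 | h0
  · exact key (x.1 - halfWidth x.2 * √(1 - (s - x.2) ^ 2)) x.1 (by ring) (by linarith) le_rfl
      (by linarith) hx1.2
  · exact key x.1 (x.1 + halfWidth x.2 * √(1 - (s - x.2) ^ 2)) (by ring) le_rfl (by linarith)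
      hx1.1 (by linarith)

theorem sectionLength_reflect {x : ℝ × ℝ} {t : ℝ} (ht0 : 0 ≤ t) (ht1 : t ≤ 1) (hx : 2 ≤ x.2)
    (h1 : ⌊x.2 + t⌋ = ⌊x.2⌋) (h2 : ⌊x.2 - t⌋ = ⌊x.2⌋) :
    sectionLength x (x.2 + t) = sectionLength x (x.2 - t) := by
  rw [sectionLength, sectionLength]
  congr 1
  ext r
  have ht : |t| ≤ 1 := abs_le.2 ⟨by linarith, ht1⟩
  rw [Set.mem_preimage, Set.mem_preimage, mem_moveSet_iff (by simpa using ht),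
    mem_moveSet_iff (by simpa using ht), halfWidth_congr h1, halfWidth_congr h2]
  have h3 : 1 ≤ x.2 + t := by linarith
  have h4 : 1 ≤ x.2 - t := by linarith
  simp [h3, h4]

/-! ### Negative mean increment of the potential -/

/-- The potential whose exponential is a drift function for the chain. -/
noncomputable def heightPotential (s : ℝ) : ℝ := s + ⌊s⌋ / 100

theorem measurable_heightPotential : Measurable heightPotential :=
  measurable_id.add ((measurable_from_top.comp Int.measurable_floor).div_const 100)

theorem abs_heightPotential_sub_le {s t : ℝ} (h : |s - t| ≤ 1) :
    |heightPotential s - heightPotential t| ≤ 2 := by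
  have h' := abs_le.1 h
  have h1 := Int.floor_le s
  have h2 := Int.lt_floor_add_one s
  have h3 := Int.floor_le t
  have h4 := Int.lt_floor_add_one t
  unfold heightPotential
  exact abs_le.2 ⟨by linarith, by linarith⟩

/-- Contribution to the mean potential increment of the heights at distance `t`. -/
noncomputable def pairedDrift (x : ℝ × ℝ) (t : ℝ) : ℝ :=
  (heightPotential (x.2 + t) - heightPotential x.2) * sectionLength x (x.2 + t) +
    (heightPotential (x.2 - t) - heightPotential x.2) * sectionLength x (x.2 - t)

theorem floor_add_eq_or {v t : ℝ} (ht0 : 0 ≤ t) (ht1 : t ≤ 1) :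
    (⌊v + t⌋ = ⌊v⌋ ∧ v + t < ⌊v⌋ + 1) ∨ (⌊v + t⌋ = ⌊v⌋ + 1 ∧ (⌊v⌋ : ℝ) + 1 ≤ v + t) := by
  have h1 := Int.floor_le v
  have h2 := Int.lt_floor_add_one v
  rcases lt_or_ge (v + t) (⌊v⌋ + 1) with h | h
  · exact Or.inl ⟨Int.floor_eq_iff.2 ⟨by linarith, h⟩, h⟩
  · exact Or.inr ⟨Int.floor_eq_iff.2 ⟨by push_cast; linarith, by push_cast; linarith⟩, h⟩

theorem floor_sub_eq_or {v t : ℝ} (ht0 : 0 ≤ t) (ht1 : t ≤ 1) :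
    (⌊v - t⌋ = ⌊v⌋ ∧ ⌊v⌋ ≤ v - t) ∨ (⌊v⌋ = ⌊v - t⌋ + 1 ∧ v - t < ⌊v⌋) := by
  have h1 := Int.floor_le v
  have h2 := Int.lt_floor_add_one v
  rcases lt_or_ge (v - t) ⌊v⌋ with h | h
  · refine Or.inr ⟨?_, h⟩
    have : ⌊v - t⌋ = ⌊v⌋ - 1 :=
      Int.floor_eq_iff.2 ⟨by push_cast; linarith, by push_cast; linarith⟩
    omega
  · exact Or.inl ⟨Int.floor_eq_iff.2 ⟨h, by linarith⟩, h⟩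

/-- The four alternatives say which of the heights x₂ ± t leave the level. If neither does, the
sections are congruent and cancel, and 2t < 1. If only the lower one does, the heights alone might
balance, and the level term of 1/100 makes the sum negative. If only the upper one does, at most
2A/3 above meets at least A below, and the level term can win only for t < 1/50. If both do, 2A/3
meets 2A. -/
theorem pairedDrift_le {x : ℝ × ℝ} (hx : x ∈ rectRegion) (hx2 : 2 ≤ x.2) {t : ℝ} (ht0 : 0 < t)
    (ht1 : t ≤ 1) {A : ℝ} (hA : A = halfWidth x.2 * √(1 - t ^ 2)) :
    (t ≤ 1 / 2 ∧ pairedDrift x t ≤ 0) ∨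
    (x.2 < ⌊x.2⌋ + 1 / 2 ∧ pairedDrift x t ≤ -(1 / 50) * A) ∨
    (⌊x.2⌋ + 1 / 2 ≤ x.2 ∧ pairedDrift x t ≤ (1 / 50 - t) / 3 * A) ∨
    (pairedDrift x t ≤ -(4 / 3) * (t + 1 / 100) * A) := by
  have ht : |t| ≤ 1 := abs_le.2 ⟨by linarith, ht1⟩
  have hp : |x.2 + t - x.2| ≤ 1 := by simpa using ht
  have hm : |x.2 - t - x.2| ≤ 1 := by simpa using ht
  have hep : (x.2 + t - x.2) ^ 2 = t ^ 2 := by ring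
  have hem : (x.2 - t - x.2) ^ 2 = t ^ 2 := by ring
  have hA0 : 0 ≤ A := hA ▸ mul_nonneg (halfWidth_pos _).le (Real.sqrt_nonneg _)
  have hs1 : 1 ≤ x.2 - t := by linarith
  rcases floor_add_eq_or (v := x.2) ht0.le ht1 with ⟨h1, h1'⟩ | ⟨h1, h1'⟩ <;>
    rcases floor_sub_eq_or (v := x.2) ht0.le ht1 with ⟨h2, h2'⟩ | ⟨h2, h2'⟩
  · refine Or.inl ⟨by linarith, ?_⟩
    rw [pairedDrift, sectionLength_reflect ht0.le ht1 hx2 h1 h2, heightPotential, heightPotential,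
      heightPotential, h1, h2]
    exact le_of_eq (by ring)
  · refine Or.inr (Or.inl ⟨by linarith, ?_⟩)
    have l1 := sectionLength_le hp
    have l2 := le_sectionLength_of_below hx hs1 hm h2
    rw [hep, ← hA] at l1
    rw [hem, ← hA] at l2
    have e : (⌊x.2⌋ : ℝ) = ⌊x.2 - t⌋ + 1 := by exact_mod_cast h2
    rw [pairedDrift, heightPotential, heightPotential, heightPotential, h1, e]
    nlinarith
  · refine Or.inr (Or.inr (Or.inl ⟨by linarith, ?_⟩))
    have l1 := sectionLength_le_of_above hp h1
    have l2 := le_sectionLength_of_floor_eq hx hs1 hm h2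
    rw [hep, ← hA] at l1
    rw [hem, ← hA] at l2
    rw [pairedDrift, heightPotential, heightPotential, heightPotential, h1, h2]
    push_cast
    nlinarith
  · refine Or.inr (Or.inr (Or.inr ?_))
    have l1 := sectionLength_le_of_above hp h1
    have l2 := le_sectionLength_of_below hx hs1 hm h2
    rw [hep, ← hA] at l1
    rw [hem, ← hA] at l2
    have e : (⌊x.2⌋ : ℝ) = ⌊x.2 - t⌋ + 1 := by exact_mod_cast h2
    rw [pairedDrift, heightPotential, heightPotential, heightPotential, h1]
    push_cast
    rw [e]
    nlinarith

theorem pairedDrift_eq_zero {x : ℝ × ℝ} {t : ℝ} (ht : 1 < t) : pairedDrift x t = 0 := by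
  have ht' : 1 < |t| := ht.trans_le (le_abs_self t)
  rw [pairedDrift, sectionLength_eq_zero (by simpa using ht'),
    sectionLength_eq_zero (by simpa using ht'), mul_zero, mul_zero, add_zero]

/-- Step functions spare the integration of √(1 - t²): it is at most 1, and at least 3/5 for t ≤
4/5. Beyond 4/5 only the sign is kept. -/
theorem exists_pairedDrift_le_step {x : ℝ × ℝ} (hx : x ∈ rectRegion) (hx2 : 2 ≤ x.2) :
    ∃ c d : ℝ, c / 2 + 3 / 10 * d ≤ -(24 / 10000) ∧ ∀ t : ℝ, 0 < t →
      pairedDrift x t ≤ halfWidth x.2 * ((Set.Ioc 0 (1 / 2)).indicator (fun _ => c) t +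
        (Set.Ioc (1 / 2) (4 / 5)).indicator (fun _ => d) t) := by
  have ha := halfWidth_pos x.2
  have hA0 : ∀ t, 0 ≤ halfWidth x.2 * √(1 - t ^ 2) := fun t => by positivity
  have hA1 : ∀ t, halfWidth x.2 * √(1 - t ^ 2) ≤ halfWidth x.2 := fun t =>
    mul_le_of_le_one_right ha.le (Real.sqrt_le_one.2 (by linarith [sq_nonneg t]))
  have hA2 : ∀ t, 0 < t → t ≤ 4 / 5 →
      halfWidth x.2 * (3 / 5) ≤ halfWidth x.2 * √(1 - t ^ 2) := fun t h0 h1 =>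
    mul_le_mul_of_nonneg_left (Real.le_sqrt_of_sq_le (by nlinarith)) ha.le
  have e1 : ∀ c t : ℝ, 0 < t → t ≤ 1 / 2 → (Set.Ioc 0 (1 / 2)).indicator (fun _ => c) t = c :=
    fun c t h0 h1 => Set.indicator_of_mem (by exact ⟨h0, h1⟩) _
  have e2 : ∀ c t : ℝ, 1 / 2 < t → (Set.Ioc 0 (1 / 2)).indicator (fun _ => c) t = 0 :=
    fun c t h1 => Set.indicator_of_notMem (fun h => absurd h.2 (not_le.2 h1)) _
  have e3 : ∀ c t : ℝ, t ≤ 1 / 2 → (Set.Ioc (1 / 2) (4 / 5)).indicator (fun _ => c) t = 0 :=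
    fun c t h1 => Set.indicator_of_notMem (fun h => absurd h.1 (not_lt.2 h1)) _
  have e4 : ∀ c t : ℝ, 1 / 2 < t → t ≤ 4 / 5 →
      (Set.Ioc (1 / 2) (4 / 5)).indicator (fun _ => c) t = c :=
    fun c t h0 h1 => Set.indicator_of_mem (by exact ⟨h0, h1⟩) _
  have e5 : ∀ c t : ℝ, 4 / 5 < t → (Set.Ioc (1 / 2) (4 / 5)).indicator (fun _ => c) t = 0 :=
    fun c t h1 => Set.indicator_of_notMem (fun h => absurd h.2 (not_le.2 h1)) _
  rcases lt_or_ge x.2 (⌊x.2⌋ + 1 / 2) with hf | hf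
  -- Lower half of the level: for t > 1/2 the weaker of the available bounds is -(4/300)A, and
  -- (4/300)(3/5) = 8/1000.
  · refine ⟨0, -(8 / 1000), by norm_num, fun t ht0 => ?_⟩
    rcases lt_or_ge 1 t with ht1 | ht1
    · rw [pairedDrift_eq_zero ht1, e2 _ _ (by linarith), e5 _ _ (by linarith)]
      simp
    have hA0t := hA0 t
    have hd := pairedDrift_le hx hx2 ht0 ht1 rfl
    rcases le_or_gt t (1 / 2) with h1 | h1
    · rw [e1 _ _ ht0 h1, e3 _ _ h1]
      rcases hd with ⟨-, h⟩ | ⟨-, h⟩ | ⟨h, -⟩ | h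
      · linarith
      · nlinarith
      · linarith
      · nlinarith [mul_nonneg ht0.le hA0t]
    have hd' : pairedDrift x t ≤ -(4 / 300) * (halfWidth x.2 * √(1 - t ^ 2)) := by
      rcases hd with ⟨h, -⟩ | ⟨-, h⟩ | ⟨h, -⟩ | h
      · linarith
      · nlinarith
      · linarith
      · nlinarith [mul_nonneg ht0.le hA0t]
    rcases le_or_gt t (4 / 5) with h2 | h2
    · rw [e2 _ _ h1, e4 _ _ h1 h2]
      nlinarith [hA2 t ht0 h2]
    · rw [e2 _ _ h1, e5 _ _ h2]
      nlinarith
  -- Upper half of the level: (1/50)/3 < 7/1000 bounds the possible gain at small t, while t > 1/2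
  -- gives a loss of at least (12/25)/3 · 3/5 > 9/100.
  · refine ⟨7 / 1000, -(9 / 100), by norm_num, fun t ht0 => ?_⟩
    rcases lt_or_ge 1 t with ht1 | ht1
    · rw [pairedDrift_eq_zero ht1, e2 _ _ (by linarith), e5 _ _ (by linarith)]
      simp
    have hA0t := hA0 t
    have hA1t := hA1 t
    have hd := pairedDrift_le hx hx2 ht0 ht1 rfl
    have htA := mul_nonneg ht0.le hA0t
    rcases le_or_gt t (1 / 2) with h1 | h1
    · rw [e1 _ _ ht0 h1, e3 _ _ h1]
      rcases hd with ⟨-, h⟩ | ⟨h, -⟩ | ⟨-, h⟩ | h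
      · nlinarith
      · linarith
      · nlinarith
      · nlinarith
    have hd' : pairedDrift x t ≤ (1 / 50 - t) / 3 * (halfWidth x.2 * √(1 - t ^ 2)) := by
      rcases hd with ⟨h, -⟩ | ⟨h, -⟩ | ⟨-, h⟩ | h
      · linarith
      · linarith
      · exact h
      · nlinarith
    have htA' := mul_le_mul_of_nonneg_right h1.le hA0t
    rcases le_or_gt t (4 / 5) with h2 | h2
    · rw [e2 _ _ h1, e4 _ _ h1 h2]
      nlinarith [hA2 t ht0 h2]
    · rw [e2 _ _ h1, e5 _ _ h2]
      nlinarith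

theorem volume_moveSet_lt_top (x : ℝ × ℝ) : volume (moveSet x) < ⊤ :=
  (measure_mono fun _ hy => hy.2.1).trans_lt (volume_ellipse_ne_top x).lt_top

theorem integrableOn_heightPotential_sub (x : ℝ × ℝ) :
    IntegrableOn (fun y : ℝ × ℝ => heightPotential y.2 - heightPotential x.2) (moveSet x) := by
  refine Measure.integrableOn_of_bounded (M := 2) (volume_moveSet_lt_top x).ne
    ((measurable_heightPotential.comp measurable_snd).sub_const _).aestronglyMeasurable ?_
  filter_upwards [ae_restrict_mem (measurableSet_moveSet x)] with y hy
  exact abs_heightPotential_sub_le (abs_sub_le_one_of_mem_moveSet hy)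

theorem setIntegral_moveSet_eq {x : ℝ × ℝ} {g : ℝ → ℝ}
    (hg : IntegrableOn (fun y : ℝ × ℝ => g y.2) (moveSet x)) :
    Integrable (fun s => g s * sectionLength x s) ∧
      ∫ y in moveSet x, g y.2 = ∫ s, g s * sectionLength x s := by
  have hi : Integrable ((moveSet x).indicator fun y : ℝ × ℝ => g y.2)
      ((volume : Measure ℝ).prod volume) :=
    (integrable_indicator_iff (measurableSet_moveSet x)).2 hg
  have hsec : ∀ s : ℝ, ∫ r : ℝ, (moveSet x).indicator (fun y : ℝ × ℝ => g y.2) (r, s) =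
      g s * sectionLength x s := by
    intro s
    have h : ∀ r : ℝ, (moveSet x).indicator (fun y : ℝ × ℝ => g y.2) (r, s) =
        ((fun r => (r, s)) ⁻¹' moveSet x).indicator (fun _ => g s) r := fun r => rfl
    simp_rw [h]
    rw [integral_indicator_const _ (measurable_prodMk_right (measurableSet_moveSet x)),
      smul_eq_mul, mul_comm]
    rfl
  constructor
  · simpa only [hsec] using hi.integral_prod_right
  · rw [← integral_indicator (measurableSet_moveSet x), Measure.volume_eq_prod,
      integral_prod_symm _ hi]
    simp_rw [hsec]

theorem integral_heightPotential_sub_le {x : ℝ × ℝ} (hx : x ∈ rectRegion) (hx2 : 2 ≤ x.2) :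
    ∫ y in moveSet x, (heightPotential y.2 - heightPotential x.2) ≤
      -(24 / 10000) * halfWidth x.2 := by
  obtain ⟨hi, he⟩ := setIntegral_moveSet_eq (g := fun s => heightPotential s - heightPotential x.2)
    (integrableOn_heightPotential_sub x)
  set F : ℝ → ℝ := fun s => (heightPotential s - heightPotential x.2) * sectionLength x s with hF
  have hi1 : Integrable fun t => F (x.2 + t) := hi.comp_add_left x.2
  have hi2 : Integrable fun t => F (x.2 + -t) := by
    simpa only [← sub_eq_add_neg] using hi.comp_sub_left x.2
  -- Reflecting the heights below x₂ pairs x₂ + t with x₂ - t.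
  have hfold : ∫ s, F s = ∫ t in Set.Ioi 0, pairedDrift x t := by
    rw [← integral_add_left_eq_self F x.2, ← integral_add_compl measurableSet_Ioi hi1,
      Set.compl_Ioi]
    have h := integral_comp_neg_Ioi 0 fun t => F (x.2 + t)
    rw [neg_zero] at h
    rw [← h, ← integral_add hi1.integrableOn hi2.integrableOn]
    rfl
  obtain ⟨c, d, hcd, hstep⟩ := exists_pairedDrift_le_step hx hx2
  have hic : IntegrableOn ((Set.Ioc (0 : ℝ) (1 / 2)).indicator fun _ => c) (Set.Ioi 0) :=
    ((integrable_indicator_iff measurableSet_Ioc).2 (integrableOn_const (by simp))).integrableOn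
  have hid : IntegrableOn ((Set.Ioc (1 / 2 : ℝ) (4 / 5)).indicator fun _ => d) (Set.Ioi 0) :=
    ((integrable_indicator_iff measurableSet_Ioc).2 (integrableOn_const (by simp))).integrableOn
  have hint : IntegrableOn (pairedDrift x) (Set.Ioi 0) := (hi1.add hi2).integrableOn
  rw [he, hfold]
  refine (setIntegral_mono_on hint ((hic.add hid).const_mul (halfWidth x.2)) measurableSet_Ioi
    fun t ht => hstep t ht).trans ?_
  have hc : ∫ t in Set.Ioi (0 : ℝ), (Set.Ioc (0 : ℝ) (1 / 2)).indicator (fun _ => c) t = c / 2 := by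
    rw [setIntegral_indicator measurableSet_Ioc, Set.inter_eq_right.2 fun t ht => ht.1,
      setIntegral_const, Real.volume_real_Ioc_of_le (by norm_num), smul_eq_mul]
    ring
  have hd : ∫ t in Set.Ioi (0 : ℝ), (Set.Ioc (1 / 2 : ℝ) (4 / 5)).indicator (fun _ => d) t =
      3 / 10 * d := by
    have hsub : Set.Ioc (1 / 2 : ℝ) (4 / 5) ⊆ Set.Ioi 0 := fun t ht =>
      lt_trans (by norm_num : (0 : ℝ) < 1 / 2) ht.1
    rw [setIntegral_indicator measurableSet_Ioc, Set.inter_eq_right.2 hsub,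
      setIntegral_const, Real.volume_real_Ioc_of_le (by norm_num), smul_eq_mul]
    ring
  simp only [Pi.add_apply]
  rw [integral_const_mul, integral_add hic hid, hc, hd]
  nlinarith [halfWidth_pos x.2]

theorem ae_abs_heightPotential_sub_le {x : ℝ × ℝ} (hx : x ∈ rectRegion) :
    ∀ᵐ y ∂(rectChain x), |heightPotential y.2 - heightPotential x.2| ≤ 2 := by
  rw [rectChain_apply hx, ae_add_measure_iff]
  refine ⟨Measure.ae_smul_measure ?_ _, Measure.ae_smul_measure ?_ _⟩
  · filter_upwards [ae_restrict_mem (measurableSet_moveSet x)] with y hy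
    exact abs_heightPotential_sub_le (abs_sub_le_one_of_mem_moveSet hy)
  · refine (ae_dirac_iff ?_).2 (by simp)
    exact measurableSet_le
      ((measurable_heightPotential.comp measurable_snd).sub_const _).abs measurable_const

theorem integrable_heightPotential_sub_rectChain {x : ℝ × ℝ} (hx : x ∈ rectRegion) :
    Integrable (fun y : ℝ × ℝ => heightPotential y.2 - heightPotential x.2) (rectChain x) :=
  Integrable.of_bound
    ((measurable_heightPotential.comp measurable_snd).sub_const _).aestronglyMeasurable 2
    (ae_abs_heightPotential_sub_le hx)

/-- Rejection contributes nothing, and |E_x| ≤ 4 · `halfWidth x.2` turns 24/10000 into 6/10000. -/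
theorem integral_heightPotential_sub_rectChain_le {x : ℝ × ℝ} (hx : x ∈ rectRegion)
    (hx2 : 2 ≤ x.2) :
    ∫ y, (heightPotential y.2 - heightPotential x.2) ∂(rectChain x) ≤ -(6 / 10000) := by
  have hi := integrable_heightPotential_sub_rectChain hx
  have hZ : 0 < (volume (ellipse x)).toReal :=
    ENNReal.toReal_pos (volume_ellipse_ne_zero x) (volume_ellipse_ne_top x)
  have hZ4 : (volume (ellipse x)).toReal ≤ 4 * halfWidth x.2 :=
    ENNReal.toReal_le_of_le_ofReal (by have := halfWidth_pos x.2; positivity) (volume_ellipse_le x)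
  rw [rectChain_apply hx] at hi ⊢
  rw [integral_add_measure hi.left_of_add_measure hi.right_of_add_measure, integral_smul_measure,
    integral_smul_measure, integral_dirac, sub_self, smul_zero, add_zero, ENNReal.toReal_inv,
    smul_eq_mul, inv_mul_le_iff₀ hZ]
  have := integral_heightPotential_sub_le hx hx2
  linarith

/-! ### The geometric drift condition -/

/-- The drift function of the chain. -/
noncomputable def driftFunction (x : ℝ × ℝ) : ℝ := Real.exp (heightPotential x.2 / 10000)

theorem driftFunction_pos (x : ℝ × ℝ) : 0 < driftFunction x := Real.exp_pos _

theorem measurable_driftFunction : Measurable driftFunction :=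
  Real.measurable_exp.comp ((measurable_heightPotential.comp measurable_snd).div_const _)

theorem lintegral_driftFunction_le_of_ae {x : ℝ × ℝ} {g : ℝ × ℝ → ℝ} (hg : Integrable g (rectChain x))
    (h : ∀ᵐ y ∂(rectChain x), driftFunction y ≤ g y) :
    ∫⁻ y, ENNReal.ofReal (driftFunction y) ∂(rectChain x) ≤
      ENNReal.ofReal (∫ y, g y ∂(rectChain x)) := by
  rw [ofReal_integral_eq_lintegral_ofReal hg
    (by filter_upwards [h] with y hy using (driftFunction_pos y).le.trans hy)]
  exact lintegral_mono_ae (by filter_upwards [h] with y hy using ENNReal.ofReal_le_ofReal hy)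

/-- With increments Δ of size at most 2, exp(Δ/10000) ≤ 1 + Δ/10000 + 4·10⁻⁸. The linear term has
mean at most -6·10⁻⁸, which beats the quadratic one. -/
theorem lintegral_driftFunction_le {x : ℝ × ℝ} (hx : x ∈ rectRegion) :
    ∫⁻ y, ENNReal.ofReal (driftFunction y) ∂(rectChain x) ≤
      ENNReal.ofReal ((1 - 1 / 100000000) * driftFunction x + Real.exp 1) := by
  have hV := driftFunction_pos x
  rcases le_or_gt 2 x.2 with hx2 | hx2
  · have hi := integrable_heightPotential_sub_rectChain hx
    refine (lintegral_driftFunction_le_of_ae (g := fun y => driftFunction x *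
      ((1 + 4 / 100000000) + 1 / 10000 * (heightPotential y.2 - heightPotential x.2)))
      (((integrable_const _).add (hi.const_mul _)).const_mul _) ?_).trans
      (ENNReal.ofReal_le_ofReal ?_)
    · filter_upwards [ae_abs_heightPotential_sub_le hx] with y hy
      have h := abs_le.1 hy
      have hz : |(heightPotential y.2 - heightPotential x.2) / 10000| ≤ 1 :=
        abs_le.2 ⟨by linarith [h.1], by linarith [h.2]⟩
      have he := (abs_le.1 (Real.abs_exp_sub_one_sub_id_le hz)).2
      have e : driftFunction y = driftFunction x *
          Real.exp ((heightPotential y.2 - heightPotential x.2) / 10000) := by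
        rw [driftFunction, driftFunction, ← Real.exp_add]
        congr 1
        ring
      rw [e]
      refine mul_le_mul_of_nonneg_left ?_ hV.le
      nlinarith [h.1, h.2]
    · rw [integral_const_mul, integral_add (integrable_const _) (hi.const_mul _),
        integral_const_mul]
      have := integral_heightPotential_sub_rectChain_le hx hx2
      simp only [integral_const, probReal_univ, smul_eq_mul, one_mul]
      nlinarith [Real.exp_pos 1]
  -- Below height 2 the potential is at most 3, hence at most 5 after one step.
  · refine (lintegral_driftFunction_le_of_ae (g := fun _ => Real.exp 1)
      (integrable_const _) ?_).trans (ENNReal.ofReal_le_ofReal ?_)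
    · filter_upwards [ae_abs_heightPotential_sub_le hx] with y hy
      refine Real.exp_le_exp.2 ?_
      have h := (abs_le.1 hy).2
      have hfl := Int.floor_le x.2
      have hW : heightPotential x.2 ≤ 3 := by
        unfold heightPotential
        linarith
      linarith
    · simp only [integral_const, probReal_univ, smul_eq_mul, one_mul]
      nlinarith

theorem rectWeight_le (y : ℝ × ℝ) :
    rectWeight y ≤ ENNReal.ofReal ((Set.Icc (-1 : ℝ) 1).indicator 1 y.1 *
      (Set.Ioi (0 : ℝ)).indicator (fun t => Real.exp (1 - t)) y.2) := by
  by_cases hm : y ∈ rectRegion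
  · obtain ⟨h1, h2⟩ := mem_rectRegion.1 hm
    have hfl : 1 ≤ ⌊y.2⌋ := Int.le_floor.2 (by simpa using h1)
    have ha : y.1 ∈ Set.Icc (-1 : ℝ) 1 :=
      abs_le.1 (h2.trans (zpow_le_one_of_nonpos₀ (by norm_num) (by omega)))
    have hb : y.2 ∈ Set.Ioi (0 : ℝ) := lt_of_lt_of_le one_pos h1
    rw [rectWeight, Set.indicator_of_mem hm, Set.indicator_of_mem ha, Set.indicator_of_mem hb,
      Pi.one_apply, one_mul]
    refine ENNReal.ofReal_le_ofReal ?_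
    have he : Real.exp 1 ≤ 3 := by linarith [Real.exp_one_lt_d9]
    calc (3 : ℝ) ^ (-⌊y.2⌋) = ((3 : ℝ) ^ ⌊y.2⌋)⁻¹ := zpow_neg _ _
      _ ≤ (Real.exp 1 ^ ⌊y.2⌋)⁻¹ :=
          inv_anti₀ (zpow_pos (Real.exp_pos 1) _)
            (zpow_le_zpow_left₀ (by omega) (Real.exp_pos 1).le he)
      _ = Real.exp (-⌊y.2⌋) := by rw [← Real.rpow_intCast, Real.exp_one_rpow, Real.exp_neg]
      _ ≤ Real.exp (1 - y.2) := Real.exp_le_exp.2 (by linarith [Int.lt_floor_add_one y.2])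
  · rw [rectWeight, Set.indicator_of_notMem hm]
    exact zero_le

/-- The weight decays at least as fast as a multiple of exp(-t), while the drift function is at most
exp(t/2) at height t > 0. -/
theorem integrable_driftFunction : Integrable driftFunction rectMeasure := by
  refine ⟨measurable_driftFunction.aestronglyMeasurable,
    (hasFiniteIntegral_iff_ofReal (Filter.Eventually.of_forall fun x =>
      (driftFunction_pos x).le)).2 ?_⟩
  rw [rectMeasure, lintegral_withDensity_eq_lintegral_mul _ measurable_rectDensity
    measurable_driftFunction.ennreal_ofReal]
  have hle : ∀ y, (rectDensity * fun y => ENNReal.ofReal (driftFunction y)) y ≤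
      (∫⁻ z, rectWeight z)⁻¹ * ENNReal.ofReal ((Set.Icc (-1 : ℝ) 1).indicator 1 y.1 *
        (Set.Ioi (0 : ℝ)).indicator (fun t => Real.exp 1 * Real.exp (-(1 / 2) * t)) y.2) := by
    intro y
    rw [Pi.mul_apply, rectDensity, mul_assoc]
    refine mul_le_mul_right ((mul_le_mul_left (rectWeight_le y) _).trans ?_) _
    rw [← ENNReal.ofReal_mul (mul_nonneg (Set.indicator_nonneg (by simp) _)
      (Set.indicator_nonneg (fun t _ => (Real.exp_pos _).le) _)), mul_assoc]
    refine ENNReal.ofReal_le_ofReal (mul_le_mul_of_nonneg_left ?_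
      (Set.indicator_nonneg (by simp) _))
    by_cases hy : y.2 ∈ Set.Ioi (0 : ℝ)
    · rw [Set.indicator_of_mem hy, Set.indicator_of_mem hy, driftFunction, ← Real.exp_add,
        ← Real.exp_add]
      refine Real.exp_le_exp.2 ?_
      have hy' : 0 < y.2 := hy
      have := Int.floor_le y.2
      unfold heightPotential
      linarith
    · rw [Set.indicator_of_notMem hy, Set.indicator_of_notMem hy, zero_mul]
  have hint : Integrable (fun y : ℝ × ℝ => (Set.Icc (-1 : ℝ) 1).indicator (1 : ℝ → ℝ) y.1 *
      (Set.Ioi (0 : ℝ)).indicator (fun t => Real.exp 1 * Real.exp (-(1 / 2) * t)) y.2) := by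
    refine Integrable.mul_prod ?_ ?_
    · exact (integrable_indicator_iff measurableSet_Icc).2 (integrableOn_const (by simp))
    · exact (integrable_indicator_iff measurableSet_Ioi).2
        ((exp_neg_integrableOn_Ioi 0 (by norm_num)).const_mul _)
  refine (lintegral_mono hle).trans_lt ?_
  rw [lintegral_const_mul' _ _ (ENNReal.inv_ne_top.2 lintegral_rectWeight_ne_zero)]
  exact ENNReal.mul_lt_top (ENNReal.inv_lt_top.2
    (pos_iff_ne_zero.2 lintegral_rectWeight_ne_zero)) hint.lintegral_lt_top

/-! ### Minorization by descent through the levels -/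

theorem mem_moveSet_of_abs_le {x : ℝ × ℝ} {r s c d : ℝ} (hy : (r, s) ∈ rectRegion)
    (h1 : |r - x.1| ≤ halfWidth x.2 * c) (h2 : |r - x.1| ≤ halfWidth s * c) (h3 : |s - x.2| ≤ d)
    (hcd : c ^ 2 + d ^ 2 ≤ 1) : (r, s) ∈ moveSet x := by
  have key : ∀ {a z t : ℝ}, 0 < a → |z| ≤ a * c → |t| ≤ d → (a⁻¹ * z) ^ 2 + t ^ 2 ≤ 1 := by
    intro a z t ha hz ht
    have hz' : |a⁻¹ * z| ≤ c := by
      rwa [abs_mul, abs_of_pos (inv_pos.2 ha), inv_mul_le_iff₀ ha]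
    have e1 := sq_le_sq' (by linarith [neg_abs_le (a⁻¹ * z)]) ((le_abs_self _).trans hz')
    have e2 := sq_le_sq' (by linarith [neg_abs_le t]) ((le_abs_self _).trans ht)
    linarith
  refine ⟨hy, mem_ellipse.2 (key (halfWidth_pos _) h1 h3), mem_ellipse.2 (key (halfWidth_pos _) ?_ ?_)⟩
  · rwa [abs_sub_comm]
  · rwa [abs_sub_comm]

theorem restrict_le_rectChain {x : ℝ × ℝ} (hx : x ∈ rectRegion) {D : Set (ℝ × ℝ)}
    (hD : D ⊆ moveSet x) :
    (ENNReal.ofReal (4 * halfWidth x.2))⁻¹ • volume.restrict D ≤ rectChain x := by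
  rw [rectChain_apply hx]
  refine le_trans ?_ (Measure.le_add_right le_rfl)
  refine Measure.le_iff.2 fun A _ => ?_
  rw [Measure.smul_apply, Measure.smul_apply, smul_eq_mul, smul_eq_mul]
  exact mul_le_mul' (ENNReal.inv_le_inv.2 (volume_ellipse_le x)) (Measure.restrict_mono hD le_rfl A)

/-- The bound 1/100 is an area of at least a/25 divided by |E_x| ≤ 4a, where a is the half-width at
`x`. -/
theorem le_rectChain_of_rectangle {x : ℝ × ℝ} (hx : x ∈ rectRegion) {l u p q : ℝ}
    {T : Set (ℝ × ℝ)} (hlu : 0 ≤ u - l) (harea : halfWidth x.2 / 25 ≤ (u - l) * (q - p))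
    (hmove : Set.Icc l u ×ˢ Set.Icc p q ⊆ moveSet x) (hT : Set.Icc l u ×ˢ Set.Icc p q ⊆ T) :
    (100 : ENNReal)⁻¹ ≤ rectChain x T := by
  have ha := halfWidth_pos x.2
  refine le_trans ?_ ((restrict_le_rectChain hx hmove T))
  rw [Measure.smul_apply, Measure.restrict_apply_superset hT, Measure.volume_eq_prod,
    Measure.prod_prod, Real.volume_Icc, Real.volume_Icc, ← ENNReal.ofReal_mul hlu, smul_eq_mul,
    ← ENNReal.ofReal_inv_of_pos (by positivity), ← ENNReal.ofReal_mul (by positivity),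
    show (100 : ENNReal) = ENNReal.ofReal 100 by norm_num,
    ← ENNReal.ofReal_inv_of_pos (by norm_num)]
  refine ENNReal.ofReal_le_ofReal ?_
  rw [le_inv_mul_iff₀ (by positivity)]
  linarith

/-- The points of the region in the central half of the lower half of their level. -/
def coreRegion : Set (ℝ × ℝ) :=
  {y | y ∈ rectRegion ∧ |y.1| ≤ halfWidth y.2 / 2 ∧ y.2 ≤ ⌊y.2⌋ + 1 / 2}

theorem measurableSet_floor_eq (k : ℤ) : MeasurableSet {y : ℝ × ℝ | ⌊y.2⌋ = k} :=
  (Int.measurable_floor.comp measurable_snd) (measurableSet_singleton k)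

theorem measurableSet_coreRegion : MeasurableSet coreRegion := by
  have h1 : Measurable fun y : ℝ × ℝ => halfWidth y.2 :=
    measurable_zpow_floor (fun k => 1 - k) measurable_snd
  have h2 : Measurable fun y : ℝ × ℝ => (⌊y.2⌋ : ℝ) :=
    measurable_from_top.comp (Int.measurable_floor.comp measurable_snd)
  exact measurableSet_rectRegion.inter ((measurableSet_le measurable_fst.abs (h1.div_const 2)).inter
    (measurableSet_le measurable_snd (h2.add_const _)))

theorem le_rectChain_core {x : ℝ × ℝ} (hx : x ∈ rectRegion) :
    (100 : ENNReal)⁻¹ ≤ rectChain x (coreRegion ∩ {y | ⌊y.2⌋ = ⌊x.2⌋}) := by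
  have ha := halfWidth_pos x.2
  obtain ⟨h1, h2⟩ := mem_rectRegion.1 hx
  have h2' := abs_le.1 h2
  have hk1 : (1 : ℝ) ≤ ⌊x.2⌋ := by exact_mod_cast Int.le_floor.2 (by simpa using h1)
  have hfl := Int.floor_le x.2
  have hfu := Int.lt_floor_add_one x.2
  -- The target is a rectangle of width a/5 and height 1/5, with a the half-width. All its points
  -- are within 7/10 vertically and 7a/10 horizontally of `x`, and 0.49 + 0.49 ≤ 1.
  have key : ∀ l u : ℝ, u - l = halfWidth x.2 / 5 → -(halfWidth x.2 / 2) ≤ l →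
      u ≤ halfWidth x.2 / 2 → x.1 - halfWidth x.2 * (7 / 10) ≤ l →
      u ≤ x.1 + halfWidth x.2 * (7 / 10) →
      (100 : ENNReal)⁻¹ ≤ rectChain x (coreRegion ∩ {y | ⌊y.2⌋ = ⌊x.2⌋}) := by
    intro l u hlu hl hu hlx hux
    have hbox : ∀ y ∈ Set.Icc l u ×ˢ Set.Icc ((⌊x.2⌋ : ℝ) + 3 / 10) (⌊x.2⌋ + 1 / 2),
        ⌊y.2⌋ = ⌊x.2⌋ ∧ |y.1| ≤ halfWidth y.2 / 2 ∧ y ∈ rectRegion := by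
      rintro ⟨r, s⟩ ⟨⟨hr1, hr2⟩, hs1, hs2⟩
      simp only at hr1 hr2 hs1 hs2
      have hf : ⌊s⌋ = ⌊x.2⌋ := Int.floor_eq_iff.2 ⟨by linarith, by linarith⟩
      have hr : |r| ≤ halfWidth s / 2 := by
        rw [halfWidth_congr hf]
        exact abs_le.2 ⟨by linarith, by linarith⟩
      exact ⟨hf, hr, mem_rectRegion.2 ⟨by linarith, hr.trans (by linarith [halfWidth_pos s])⟩⟩
    refine le_rectChain_of_rectangle hx (l := l) (u := u) (p := ⌊x.2⌋ + 3 / 10)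
      (q := ⌊x.2⌋ + 1 / 2) (by linarith) (by rw [hlu]; linarith) ?_ ?_
    · rintro ⟨r, s⟩ hy
      obtain ⟨hf, -, hR⟩ := hbox _ hy
      obtain ⟨⟨hr1, hr2⟩, hs1, hs2⟩ := hy
      simp only at hr1 hr2 hs1 hs2 hf
      have hr : |r - x.1| ≤ halfWidth x.2 * (7 / 10) := abs_le.2 ⟨by linarith, by linarith⟩
      exact mem_moveSet_of_abs_le (c := 7 / 10) (d := 7 / 10) hR hr (by rwa [halfWidth_congr hf])
        (abs_le.2 ⟨by linarith, by linarith⟩) (by norm_num)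
    · intro y hy
      obtain ⟨hf, hr, hR⟩ := hbox y hy
      exact ⟨⟨hR, hr, by rw [hf]; exact hy.2.2⟩, hf⟩
  rcases le_total 0 x.1 with h0 | h0
  · exact key (3 / 10 * halfWidth x.2) (halfWidth x.2 / 2) (by ring) (by linarith) le_rfl
      (by linarith) (by linarith)
  · exact key (-(halfWidth x.2 / 2)) (-(3 / 10 * halfWidth x.2)) (by ring) le_rfl (by linarith)
      (by linarith) (by linarith)

/-- Starting in the core keeps the target within 4/5 vertically and 59/100 of the half-width
horizontally, and 0.64 + 0.3481 ≤ 1. From the top of a level or from its edge the same rectangle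
might be out of reach. -/
theorem le_rectChain_level_below {x : ℝ × ℝ} (hx : x ∈ coreRegion) {k : ℤ} (hk : 1 ≤ k)
    (hxk : ⌊x.2⌋ = k + 1) :
    (100 : ENNReal)⁻¹ ≤ rectChain x (rectRegion ∩ {y | ⌊y.2⌋ = k}) := by
  have ha := halfWidth_pos x.2
  obtain ⟨hR, h2, h3⟩ := hx
  have h2' := abs_le.1 h2
  have hk1 : (1 : ℝ) ≤ k := by exact_mod_cast hk
  have hfl := Int.floor_le x.2
  rw [hxk] at h3 hfl
  push_cast at h3 hfl
  have hbox : ∀ y ∈ Set.Icc (-(9 / 100 * halfWidth x.2)) (9 / 100 * halfWidth x.2) ×ˢ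
      Set.Icc ((k : ℝ) + 7 / 10) (k + 19 / 20),
      ⌊y.2⌋ = k ∧ halfWidth x.2 ≤ halfWidth y.2 ∧ y ∈ rectRegion := by
    rintro ⟨r, s⟩ ⟨⟨hr1, hr2⟩, hs1, hs2⟩
    simp only at hr1 hr2 hs1 hs2
    have hf : ⌊s⌋ = k := Int.floor_eq_iff.2 ⟨by linarith, by linarith⟩
    have hw := halfWidth_of_floor_eq_add_one (s := x.2) (t := s) (by rw [hxk, hf])
    exact ⟨hf, by linarith, mem_rectRegion.2 ⟨by linarith, abs_le.2 ⟨by linarith, by linarith⟩⟩⟩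
  refine le_rectChain_of_rectangle hR (l := -(9 / 100 * halfWidth x.2))
    (u := 9 / 100 * halfWidth x.2) (p := k + 7 / 10) (q := k + 19 / 20) (by linarith)
    (by linarith) ?_ ?_
  · rintro ⟨r, s⟩ hy
    obtain ⟨hf, hw, hyR⟩ := hbox _ hy
    obtain ⟨⟨hr1, hr2⟩, hs1, hs2⟩ := hy
    simp only at hr1 hr2 hs1 hs2 hf hw
    have hr : |r - x.1| ≤ halfWidth x.2 * (59 / 100) := abs_le.2 ⟨by linarith, by linarith⟩
    exact mem_moveSet_of_abs_le (c := 59 / 100) (d := 8 / 10) hyR hr (hr.trans (by linarith))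
      (abs_le.2 ⟨by linarith, by linarith⟩) (by norm_num)
  · exact fun y hy => ⟨(hbox y hy).2.2, (hbox y hy).1⟩

/-- A rectangle to which the chain can move at once from the core of the lowest level. -/
def baseBox : Set (ℝ × ℝ) := Set.Icc (-(1 / 10)) (1 / 10) ×ˢ Set.Icc (13 / 10) (3 / 2)

theorem halfWidth_eq_one {t : ℝ} (h : ⌊t⌋ = 1) : halfWidth t = 1 := by
  rw [halfWidth, h, sub_self, zpow_zero]

theorem baseBox_subset_moveSet {x : ℝ × ℝ} (hx : x ∈ coreRegion) (hx1 : ⌊x.2⌋ = 1) :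
    baseBox ⊆ moveSet x := by
  obtain ⟨hR, h2, h3⟩ := hx
  have hfl := Int.floor_le x.2
  rw [halfWidth_eq_one hx1] at h2
  rw [hx1] at h3 hfl
  push_cast at h3 hfl
  have h2' := abs_le.1 h2
  rintro ⟨r, s⟩ ⟨⟨hr1, hr2⟩, hs1, hs2⟩
  simp only at hr1 hr2 hs1 hs2
  have hf : ⌊s⌋ = 1 := Int.floor_eq_iff.2 ⟨by push_cast; linarith, by push_cast; linarith⟩
  have hr : |r - x.1| ≤ 1 * (6 / 10) := abs_le.2 ⟨by linarith, by linarith⟩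
  refine mem_moveSet_of_abs_le (c := 6 / 10) (d := 1 / 2) (mem_rectRegion.2 ⟨by linarith, ?_⟩)
    (by rwa [halfWidth_eq_one hx1]) (by rwa [halfWidth_eq_one hf])
    (abs_le.2 ⟨by linarith, by linarith⟩) (by norm_num)
  rw [halfWidth_eq_one hf]
  exact abs_le.2 ⟨by linarith, by linarith⟩

/-- Chapman–Kolmogorov, keeping only the paths whose first step lands in `T`. -/
theorem mul_le_kernel_pow_succ {X : Type*} [MeasurableSpace X] (P : Kernel X X) {n : ℕ} {x : X}
    {T T' : Set X} (hT : MeasurableSet T) (hT' : MeasurableSet T') {c d : ENNReal} (hc : c ≤ P x T)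
    (hd : ∀ y ∈ T, d ≤ (P ^ n) y T') : d * c ≤ (P ^ (n + 1)) x T' := by
  rw [add_comm, Kernel.pow_add_apply_eq_lintegral P 1 n x hT', pow_one]
  calc d * c ≤ d * P x T := by gcongr
    _ = ∫⁻ _ in T, d ∂(P x) := (setLIntegral_const _ _).symm
    _ ≤ ∫⁻ y in T, (P ^ n) y T' ∂(P x) := setLIntegral_mono' hT hd
    _ ≤ ∫⁻ y, (P ^ n) y T' ∂(P x) := setLIntegral_le_lintegral _ _

/-- Each level costs two steps, one into its core and one down, and level 1 a last one into its
core. The chain can then wait in that core, so every larger `n` works and points of different levels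
share one number of steps. -/
theorem pow_le_rectChain_pow_core (k : ℕ) : ∀ n : ℕ, 2 * k + 1 ≤ n → ∀ x ∈ rectRegion,
    ⌊x.2⌋ = (k : ℤ) + 1 →
    ((100 : ENNReal)⁻¹) ^ n ≤ (rectChain ^ n) x (coreRegion ∩ {y | ⌊y.2⌋ = 1}) := by
  have hC : ∀ j : ℤ, MeasurableSet (coreRegion ∩ {y : ℝ × ℝ | ⌊y.2⌋ = j}) := fun j =>
    measurableSet_coreRegion.inter (measurableSet_floor_eq j)
  have hcore : ∀ n : ℕ, ∀ x ∈ coreRegion, ⌊x.2⌋ = 1 →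
      ((100 : ENNReal)⁻¹) ^ n ≤ (rectChain ^ n) x (coreRegion ∩ {y | ⌊y.2⌋ = 1}) := by
    intro n
    induction n with
    | zero =>
      intro x hx hx1
      rw [pow_zero, pow_zero]
      change 1 ≤ Kernel.id x _
      rw [Kernel.id_apply, Measure.dirac_apply_of_mem
        (show x ∈ coreRegion ∩ {y | ⌊y.2⌋ = 1} from ⟨hx, hx1⟩)]
    | succ n ih =>
      intro x hx hx1
      rw [pow_succ]
      exact mul_le_kernel_pow_succ _ (hC 1) (hC 1) (hx1 ▸ le_rectChain_core hx.1)
        fun y hy => ih y hy.1 hy.2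
  induction k with
  | zero =>
    intro n hn x hx hx1
    obtain ⟨n, rfl⟩ : ∃ j, n = j + 1 := ⟨n - 1, by omega⟩
    have hx1' : ⌊x.2⌋ = 1 := by simpa using hx1
    rw [pow_succ]
    exact mul_le_kernel_pow_succ _ (hC 1) (hC 1) (hx1' ▸ le_rectChain_core hx)
      fun y hy => hcore n y hy.1 hy.2
  | succ k ih =>
    intro n hn x hx hx1
    obtain ⟨n, rfl⟩ : ∃ j, n = j + 1 + 1 := ⟨n - 2, by omega⟩
    rw [pow_succ]
    refine mul_le_kernel_pow_succ _ (hC _) (hC 1) (le_rectChain_core hx) fun y hy => ?_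
    have hy2 : ⌊y.2⌋ = ((k : ℤ) + 1) + 1 := by rw [hy.2, hx1]; push_cast; rfl
    rw [pow_succ]
    exact mul_le_kernel_pow_succ _
      (measurableSet_rectRegion.inter (measurableSet_floor_eq ((k : ℤ) + 1))) (hC 1)
      (le_rectChain_level_below hy.1 (by omega) hy2) fun z hz => ih n (by omega) z hz.1 hz.2

theorem exists_minorization (C : ℝ) : ∃ (m : ℕ) (ν : Measure (ℝ × ℝ)), IsFiniteMeasure ν ∧
    ν Set.univ ≠ 0 ∧ ∀ x ∈ rectRegion, driftFunction x ≤ C → ν ≤ (rectChain ^ (m + 1)) x := by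
  -- From 1 + z ≤ exp z, a bound `C` on the drift function forces x₂ < N and so bounds the level.
  obtain ⟨N, hN⟩ := exists_nat_gt (10000 * C)
  have hc0 : ((100 : ENNReal)⁻¹) ^ (2 * N + 1) ≠ 0 := pow_ne_zero _ (by simp)
  have hct : ((100 : ENNReal)⁻¹) ^ (2 * N + 1) ≠ ⊤ := ENNReal.pow_ne_top (by simp)
  have h40 : (ENNReal.ofReal 4)⁻¹ ≠ 0 := ENNReal.inv_ne_zero.2 ENNReal.ofReal_ne_top
  have h4t : (ENNReal.ofReal 4)⁻¹ ≠ ⊤ := ENNReal.inv_ne_top.2 (by norm_num)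
  have hvol : volume baseBox = ENNReal.ofReal (1 / 5) * ENNReal.ofReal (1 / 5) := by
    rw [baseBox, Measure.volume_eq_prod, Measure.prod_prod, Real.volume_Icc, Real.volume_Icc]
    norm_num
  have hmass : (((100 : ENNReal)⁻¹) ^ (2 * N + 1) •
      ((ENNReal.ofReal 4)⁻¹ • volume.restrict baseBox)) Set.univ =
      ((100 : ENNReal)⁻¹) ^ (2 * N + 1) * ((ENNReal.ofReal 4)⁻¹ *
        (ENNReal.ofReal (1 / 5) * ENNReal.ofReal (1 / 5))) := by
    rw [Measure.smul_apply, Measure.smul_apply, Measure.restrict_apply_univ, hvol, smul_eq_mul,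
      smul_eq_mul]
  -- There are 2N + 1 steps into the core of level 1 and one more to spread over `baseBox`, with
  -- density at least 1/4 because the half-width there is 1.
  refine ⟨2 * N + 1, ((100 : ENNReal)⁻¹) ^ (2 * N + 1) •
    ((ENNReal.ofReal 4)⁻¹ • volume.restrict baseBox), ⟨?_⟩, ?_, fun x hx hxC => ?_⟩
  · rw [hmass]
    exact (ENNReal.mul_ne_top hct (ENNReal.mul_ne_top h4t
      (ENNReal.mul_ne_top ENNReal.ofReal_ne_top ENNReal.ofReal_ne_top))).lt_top
  · rw [hmass]
    have h5 : ENNReal.ofReal (1 / 5) ≠ 0 := (ENNReal.ofReal_pos.2 (by norm_num)).ne'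
    exact mul_ne_zero hc0 (mul_ne_zero h40 (mul_ne_zero h5 h5))
  have h1 := (mem_rectRegion.1 hx).1
  have hk1 : 1 ≤ ⌊x.2⌋ := Int.le_floor.2 (by simpa using h1)
  have hk1' : (1 : ℝ) ≤ ⌊x.2⌋ := by exact_mod_cast hk1
  have hxN : x.2 < N := by
    have h2 := (Real.add_one_le_exp (heightPotential x.2 / 10000)).trans hxC
    unfold heightPotential at h2
    linarith
  obtain ⟨k, hk⟩ : ∃ k : ℕ, ⌊x.2⌋ = (k : ℤ) + 1 := ⟨(⌊x.2⌋ - 1).toNat, by omega⟩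
  have hkN : k ≤ N := by
    have h3 : ((k : ℤ) + 1 : ℝ) ≤ x.2 := by
      have := Int.floor_le x.2
      rw [hk] at this
      exact_mod_cast this
    have h4 : (k : ℝ) < N := by
      push_cast at h3
      linarith
    exact_mod_cast h4.le
  have hpow := pow_le_rectChain_pow_core k (2 * N + 1) (by omega) x hx hk
  have hC : MeasurableSet (coreRegion ∩ {y : ℝ × ℝ | ⌊y.2⌋ = 1}) :=
    measurableSet_coreRegion.inter (measurableSet_floor_eq 1)
  refine Measure.le_iff.2 fun A hA => ?_
  rw [Kernel.pow_succ_apply_eq_lintegral _ _ _ hA, Measure.smul_apply, smul_eq_mul, mul_comm]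
  set ν₀ : Measure (ℝ × ℝ) := (ENNReal.ofReal 4)⁻¹ • volume.restrict baseBox with hν₀
  calc ν₀ A * ((100 : ENNReal)⁻¹) ^ (2 * N + 1)
      ≤ ν₀ A * (rectChain ^ (2 * N + 1)) x (coreRegion ∩ {y | ⌊y.2⌋ = 1}) := by gcongr
    _ = ∫⁻ _ in coreRegion ∩ {y | ⌊y.2⌋ = 1}, ν₀ A ∂((rectChain ^ (2 * N + 1)) x) :=
        (setLIntegral_const _ _).symm
    _ ≤ ∫⁻ y in coreRegion ∩ {y | ⌊y.2⌋ = 1}, rectChain y A ∂((rectChain ^ (2 * N + 1)) x) := by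
        refine setLIntegral_mono' hC fun y hy => ?_
        have h := restrict_le_rectChain hy.1.1 (baseBox_subset_moveSet hy.1 hy.2)
        rw [halfWidth_eq_one hy.2, mul_one] at h
        exact h A
    _ ≤ ∫⁻ y, rectChain y A ∂((rectChain ^ (2 * N + 1)) x) := setLIntegral_le_lintegral _ _

theorem lemma7 : GeometricallyErgodic rectChain rectMeasure :=
  geometricallyErgodic_of_drift_of_minorization rectChain rectMeasure
    rectChain_isReversible.invariant measurableSet_rectRegion ae_mem_rectRegion_rectMeasure
    (fun _ hx => ae_mem_rectRegion_rectChain hx) measurable_driftFunction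
    (fun x => (driftFunction_pos x).le) integrable_driftFunction (by norm_num) (by norm_num)
    (Real.exp_pos 1) (fun _ hx => lintegral_driftFunction_le hx) exists_minorization
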